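/- **Setting.** Let $A\in\mathbb R^{n\times n}$, $B\in\mathbb R^{n\times m}$ with $(A,B)$ controllable, and consider $x_{k+1}=Ax_k+Bu_k$ with the quadratic costs $\|z_k-H_k\chi_k\|_W^2$ for tracking a reference $z_0,z_1,\dots\in\mathbb R^p$ and $\|u_k-u_{k-1}\|_V^2$ for control changes, where $\chi_k=(x_k,u_k)$, $W$ and $V$ are symmetric positive definite and $H_k=H$ for all $k\ge1$ ($H_0$ is arbitrary). Put $\Phi=\begin{bmatrix}A&B\\0&I\end{bmatrix}$, $\Phi_{-1}=I$, $\Phi_k=\Phi$ for $k\ge 0$, $\grave Q=\mathrm{diag}(0,V^{-1})$, $\grave R=W^{-1}$, and suppose that $(\Phi,H)$ is detectable (automatic for $H=I$, where every state and control is penalized). The associated Kalman filter is $P_{0(-)}=\grave Q$, $S_k=H_k^\top(H_kP_{k(-)}H_k^\top+\grave R)^{-1}$, $K_k=P_{k(-)}S_k$, $P_{k+1(-)}=\Phi(I-K_kH_k)P_{k(-)}\Phi^\top+\grave Q$, with $G_{-1}=[0\ \ I]\grave Q$, $G_k=G_{k-1}\Phi_{k-1}^\top(I-K_kH_k)^\top$.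 For a current state $x$ and a previous control $u_{\rm last}$ put $\chi_{0(-)}=(x,u_{\rm last})$, $r_k=z_k-H_k\chi_{k(-)}$, $\chi_{k+1(-)}=\Phi(\chi_{k(-)}+K_kr_k)$. The predictive control with horizon $M$ is $$u^{[M]}=u_{\rm last}+\sum_{k=0}^{M}G_{k-1}\Phi_{k-1}^\top S_kr_k .$$ Let $u_\infty=\lim_{M\to\infty}u^{[M]}$, and let $u_N$ be the value of $u_\infty$ for the reference $z_{\min(k,N)}$, that is, when all increments $z_k-z_{k-1}$ with $k>N$ are neglected. Norms are Euclidean norms and spectral norms. **Claim.** 1. $P_{k(-)}$ converges, and all eigenvalues of the limiting closed loop $(I-K_\infty H)\Phi$ lie in the open unit disc; let $\lambda_{\max}<1$ be their largest modulus. For every $\lambda\in(0,1)$ with $\lambda>\lambda_{\max}$ there are constants $c,\gamma_1,\gamma_2$, depending only on $A,B,H_0,H,W,V$ and $\lambda$, with $$\Bigl\|(I-K_{j+l-1}H)\Phi\cdots(I-K_{j}H)\Phi\Bigr\|\le c\,\lambda^{l},\qquad \|\Phi^\top S_k\|\le\gamma_1,\qquad \|\Phi^\top S_jH\Phi\|\,\|K_k\|\le\gamma_2\qquad(j,k\ge1,\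 l\ge0).\tag{$*$}$$ 2. If, for some $N$ and $\delta$, $\|z_k-z_{k-1}\|<\delta$ for all $k>N$, then $u_\infty$ exists (the limit converges). 3. If $0<\lambda<1$ and $(*)$ holds, then for all $N\ge 0$, all $\delta$, all $x$, $u_{\rm last}$ and every reference with $\|z_k-z_{k-1}\|<\delta$ for all $k>N$, $$\|u_\infty-u_N\|\le\left(\frac{\|G_0\|\,c\,\gamma_1\lambda^{-1}\,\lambda^{N+1}}{(1-\lambda)^2}+\frac{\|G_0\|\,c^2\,\gamma_2\,\lambda^{N+1}}{(1-\lambda^2)(1-\lambda)^2}\right)\delta .$$ 4. Hence for all $\varepsilon,\delta>0$ there is a finite $N_0$ such that for all $N\ge N_0$, all $x,u_{\rm last}$ and all references, $\|u_\infty-u_N\|<\varepsilon$ if $\|z_k-z_{k-1}\|<\delta$ for all $k>N$. 5. Likewise for the control with truncated horizon: for all $\varepsilon,\delta,\rho>0$ there is $N_0$ such that $\|u_\infty-u^{[N]}\|<\varepsilon$ for all $N\ge N_0$ whenever $\|x\|,\|u_{\rm last}\|,\|z_0\|\le\rho$ and $\|z_k-z_{k-1}\|<\delta$ for all $k\ge1$.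 -/

import Mathlib

open Filter Topology
open scoped Matrix Matrix.Norms.L2Operator

noncomputable section

/-- `(A, B)` is controllable: the controllability matrix `[B, AB, …, Aⁿ⁻¹B]` has rank `n`. -/
def IsControllable {n m : ℕ} (A : Matrix (Fin n) (Fin n) ℝ) (B : Matrix (Fin n) (Fin m) ℝ) : Prop :=
  (Matrix.of fun (i : Fin n) (kj : Fin n × Fin m) => (A ^ (kj.1 : ℕ) * B) i kj.2).rank = n

/-- All complex eigenvalues of the real matrix `M` lie in the open disc of radius `r`. -/
def EigenvaluesLt {ι : Type} [Fintype ι] [DecidableEq ι] (M : Matrix ι ι ℝ) (r : ℝ) : Prop :=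
  ∀ μ ∈ spectrum ℂ (M.map (fun a : ℝ => (a : ℂ))), ‖μ‖ < r

/-- `(F, H)` is detectable: `F - L H` is Schur stable for some gain `L`. -/
def IsDetectable {ι : Type} [Fintype ι] [DecidableEq ι] {p : ℕ}
    (F : Matrix ι ι ℝ) (H : Matrix (Fin p) ι ℝ) : Prop :=
  ∃ L : Matrix ι (Fin p) ℝ, EigenvaluesLt (F - L * H) 1

/-- Matrix times Euclidean vector. -/
def act {ι κ : Type} [Fintype ι] (M : Matrix κ ι ℝ) (v : EuclideanSpace ℝ ι) :
    EuclideanSpace ℝ κ :=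
  WithLp.toLp 2 (M *ᵥ v.ofLp)

/-- Data of a linear time-invariant tracking problem with quadratic costs: dynamics
`x⁺ = A x + B u`, tracking cost `‖z_k - H_k (x_k, u_k)‖²_W` with `H_k = H₀` for `k = 0` and
`H_k = H` for `k ≥ 1`, and control-rate cost `‖u_k - u_{k-1}‖²_V`. -/
structure TrackingProblem (n m p : ℕ) where
  /-- state matrix -/
  A : Matrix (Fin n) (Fin n) ℝ
  /-- input matrix -/
  B : Matrix (Fin n) (Fin m) ℝ
  /-- measurement matrix on the augmented state at the current time -/
  H₀ : Matrix (Fin p) (Fin n ⊕ Fin m) ℝ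
  /-- measurement matrix on the augmented state at all future times -/
  H : Matrix (Fin p) (Fin n ⊕ Fin m) ℝ
  /-- weight of the tracking error; the state, control and coupling weights when `H = 1` -/
  W : Matrix (Fin p) (Fin p) ℝ
  /-- weight of the control increments -/
  V : Matrix (Fin m) (Fin m) ℝ

namespace TrackingProblem

variable {n m p : ℕ} (T : TrackingProblem n m p)

/-- Augmented dynamics `Φ = [A B; 0 I]`. -/
def Phi : Matrix (Fin n ⊕ Fin m) (Fin n ⊕ Fin m) ℝ := Matrix.fromBlocks T.A T.B 0 1

/-- Process covariance `diag(0, V⁻¹)`. -/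
def Qn : Matrix (Fin n ⊕ Fin m) (Fin n ⊕ Fin m) ℝ := Matrix.fromBlocks 0 0 0 T.V⁻¹

/-- Measurement covariance `W⁻¹`. -/
def Rn : Matrix (Fin p) (Fin p) ℝ := T.W⁻¹

/-- `H_k`. -/
def Hk : ℕ → Matrix (Fin p) (Fin n ⊕ Fin m) ℝ
  | 0 => T.H₀
  | _ + 1 => T.H

/-- `PhiPrev k` is `Φ_{k-1}`, where `Φ_{-1} = I`. -/
def PhiPrev : ℕ → Matrix (Fin n ⊕ Fin m) (Fin n ⊕ Fin m) ℝ
  | 0 => 1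
  | _ + 1 => T.Phi

/-- `Hᵀ (H P Hᵀ + R)⁻¹` for a prior covariance `P` and a measurement matrix `H`. -/
def innovation (H : Matrix (Fin p) (Fin n ⊕ Fin m) ℝ)
    (P : Matrix (Fin n ⊕ Fin m) (Fin n ⊕ Fin m) ℝ) : Matrix (Fin n ⊕ Fin m) (Fin p) ℝ :=
  Hᵀ * (H * P * Hᵀ + T.Rn)⁻¹

/-- Prior covariances `P_{k(-)}` of the Kalman filter, started at `P_{0(-)} = diag(0, V⁻¹)`. -/
def prior : ℕ → Matrix (Fin n ⊕ Fin m) (Fin n ⊕ Fin m) ℝ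
  | 0 => T.Qn
  | k + 1 =>
    T.Phi * ((1 - (prior k * T.innovation (T.Hk k) (prior k)) * T.Hk k) * prior k) * T.Phiᵀ + T.Qn

/-- `S_k = H_kᵀ (H_k P_{k(-)} H_kᵀ + R)⁻¹`. -/
def S (k : ℕ) : Matrix (Fin n ⊕ Fin m) (Fin p) ℝ := T.innovation (T.Hk k) (T.prior k)

/-- Kalman gains `K_k = P_{k(-)} S_k`. -/
def K (k : ℕ) : Matrix (Fin n ⊕ Fin m) (Fin p) ℝ := T.prior k * T.S k

/-- `GPrev k` is the accumulated gain `G_{k-1}`: `G_{-1} = [0 I] P_{0(-)}` and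
`G_k = G_{k-1} Φ_{k-1}ᵀ (I - K_k H_k)ᵀ`. -/
def GPrev : ℕ → Matrix (Fin m) (Fin n ⊕ Fin m) ℝ
  | 0 => Matrix.fromCols 0 1 * T.prior 0
  | k + 1 => GPrev k * (T.PhiPrev k)ᵀ * (1 - T.K k * T.Hk k)ᵀ

/-- Prior augmented states `χ_{k(-)}` of the Kalman filter that is fed with the reference `z` as
measurements and started at the current state `x` and the previously applied control `u`. -/
def chi (x : EuclideanSpace ℝ (Fin n)) (u : EuclideanSpace ℝ (Fin m))
    (z : ℕ → EuclideanSpace ℝ (Fin p)) : ℕ → EuclideanSpace ℝ (Fin n ⊕ Fin m)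
  | 0 => WithLp.toLp 2 (Sum.elim x.ofLp u.ofLp)
  | k + 1 => act T.Phi (chi x u z k + act (T.K k) (z k - act (T.Hk k) (chi x u z k)))

/-- Residuals `r_k = z_k - H_k χ_{k(-)}`. -/
def residual (x : EuclideanSpace ℝ (Fin n)) (u : EuclideanSpace ℝ (Fin m))
    (z : ℕ → EuclideanSpace ℝ (Fin p)) (k : ℕ) : EuclideanSpace ℝ (Fin p) :=
  z k - act (T.Hk k) (T.chi x u z k)

/-- The predictive control `u_0` computed with horizon `N`:
`u + ∑_{k = 0}^{N} G_{k-1} Φ_{k-1}ᵀ S_k r_k`. -/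
def control (N : ℕ) (x : EuclideanSpace ℝ (Fin n)) (u : EuclideanSpace ℝ (Fin m))
    (z : ℕ → EuclideanSpace ℝ (Fin p)) : EuclideanSpace ℝ (Fin m) :=
  u + ∑ k ∈ Finset.range (N + 1),
    act (T.GPrev k * (T.PhiPrev k)ᵀ * T.S k) (T.residual x u z k)

/-- The infinite-horizon control, the limit of the controls of horizon `M` as `M → ∞`. -/
def controlInf (x : EuclideanSpace ℝ (Fin n)) (u : EuclideanSpace ℝ (Fin m))
    (z : ℕ → EuclideanSpace ℝ (Fin p)) : EuclideanSpace ℝ (Fin m) :=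
  limUnder atTop fun M : ℕ => T.control M x u z

/-- The infinite-horizon control when only `z_0, …, z_N` are taken into account, that is, when all
reference increments `z_k - z_{k-1}` with `k > N` are neglected. -/
def controlKnown (N : ℕ) (x : EuclideanSpace ℝ (Fin n)) (u : EuclideanSpace ℝ (Fin m))
    (z : ℕ → EuclideanSpace ℝ (Fin p)) : EuclideanSpace ℝ (Fin m) :=
  T.controlInf x u fun k => z (min k N)

/-- Closed-loop matrix `(I - K H) Φ` of the filter for the prior covariance `P`. -/
def closedLoop (P : Matrix (Fin n ⊕ Fin m) (Fin n ⊕ Fin m) ℝ) :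
    Matrix (Fin n ⊕ Fin m) (Fin n ⊕ Fin m) ℝ :=
  (1 - (P * T.innovation T.H P) * T.H) * T.Phi

/-- The product `(I - K_{j+l-1} H_{j+l-1}) Φ ⋯ (I - K_j H_j) Φ` of `l` factors. -/
def transition (j : ℕ) : ℕ → Matrix (Fin n ⊕ Fin m) (Fin n ⊕ Fin m) ℝ
  | 0 => 1
  | l + 1 => ((1 - T.K (j + l) * T.Hk (j + l)) * T.Phi) * transition j l

/-- `r` is a geometric rate, with constant `c`, for the closed-loop products of the filter, and
`γ₁`, `γ₂` bound the gains `‖Φᵀ S_k‖` and `‖Φᵀ S_j H Φ‖ ‖K_k‖` (all in the spectral norm). -/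
structure GainBounds (r c γ₁ γ₂ : ℝ) : Prop where
  transition_le : ∀ j l : ℕ, 1 ≤ j → ‖T.transition j l‖ ≤ c * r ^ l
  gain₁_le : ∀ k : ℕ, 1 ≤ k → ‖T.Phiᵀ * T.S k‖ ≤ γ₁
  gain₂_le : ∀ j k : ℕ, 1 ≤ j → 1 ≤ k → ‖T.Phiᵀ * T.S j * T.H * T.Phi‖ * ‖T.K k‖ ≤ γ₂

end TrackingProblem

end

/-! The control is a sum of residuals weighted by accumulated gains, so everything rests on
geometric decay of the closed-loop products of the filter.

Stability: among all predictor gains the Kalman gain minimizes the next covariance (`gainCov_eq`,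
completing the square), so the Riccati map is monotone in the positive semidefinite order. A
detecting gain bounds its iterates from zero by a convergent Lyapunov series; being increasing, they
converge to a fixed point `P`. On a left eigenvector of the closed loop with modulus at least 1, the
fixed-point equation forces both noise terms to vanish; it would be a left eigenvector of `Φ` that
the process noise does not reach, which controllability excludes (`Phi_reachable`). Freezing the
stable limiting gain then squeezes the iterates from any nonnegative start to `P`, and convergence
of the factors gives their products every rate above the spectral radius
(`exists_norm_orderedProd_le`).

Estimates: the filter is affine in its data, so altering the reference after time `N` acts as the
response from zero initial data to a signal that vanishes up to `N` and grows at most linearly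
afterwards. The accumulated gains decay geometrically. The direct effect of the signal sums to a
multiple of `∑ (j + 1) r ^ j`, and its effect through the filter state to a convolution; these are
the two terms of the bound. The same decay yields summability and uniform tails. -/

set_option linter.unusedSectionVars false

/-! ### Decay rates of matrix powers and of products of converging matrices. -/

section PowerRates

theorem tendsto_matrix_iff {α : Type*} {ι κ : Type} {l : Filter α}
    {f : α → Matrix ι κ ℝ} {M : Matrix ι κ ℝ} :
    Tendsto f l (𝓝 M) ↔ ∀ i j, Tendsto (fun a => f a i j) l (𝓝 (M i j)) :=
  (tendsto_pi_nhds (f := f) (g := M)).trans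
    (forall_congr' fun i => tendsto_pi_nhds (f := fun a => f a i) (g := M i))

variable {ι : Type} [Fintype ι] [DecidableEq ι]

/-- Gelfand's formula: the powers are eventually below `s ^ k` for some `s` between the spectral
radius and `r`. -/
theorem tendsto_inv_smul_pow_of_spectrum_lt {E : Type*} [NormedRing E] [NormedAlgebra ℂ E]
    [CompleteSpace E] [Nontrivial E] (a : E) {r : ℝ} (hr : 0 < r)
    (h : ∀ μ ∈ spectrum ℂ a, ‖μ‖ < r) :
    Tendsto (fun k : ℕ => (r⁻¹) ^ k * ‖a ^ k‖) atTop (𝓝 0) := by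
  lift r to NNReal using hr.le
  have hr' : (0 : NNReal) < r := by exact_mod_cast hr
  have h1 : spectralRadius ℂ a < r :=
    spectrum.spectralRadius_lt_of_forall_lt a (fun k hk => by exact_mod_cast h k hk)
  obtain ⟨s, hs1, hs2⟩ := ENNReal.lt_iff_exists_nnreal_btwn.1 h1
  have hsr : s < r := by exact_mod_cast hs2
  have h2 := spectrum.pow_nnnorm_pow_one_div_tendsto_nhds_spectralRadius a
  have h3 : ∀ᶠ k : ℕ in atTop, ‖a ^ k‖ ≤ (s : ℝ) ^ k := by
    filter_upwards [h2.eventually (gt_mem_nhds hs1), eventually_gt_atTop 0] with k hk hk0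
    have hk0' : (0 : ℝ) < k := by exact_mod_cast hk0
    have h4 := ENNReal.rpow_le_rpow hk.le hk0'.le
    rw [← ENNReal.rpow_mul, one_div, inv_mul_cancel₀ hk0'.ne', ENNReal.rpow_one,
      ENNReal.rpow_natCast] at h4
    exact_mod_cast h4
  have h5 : Tendsto (fun k : ℕ => ((s : ℝ) / r) ^ k) atTop (𝓝 0) :=
    tendsto_pow_atTop_nhds_zero_of_lt_one (by positivity)
      ((div_lt_one hr).2 (by exact_mod_cast hsr))
  refine squeeze_zero' (Eventually.of_forall fun k => by positivity) ?_ h5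
  filter_upwards [h3] with k hk
  rw [div_pow, inv_pow, div_eq_inv_mul]
  gcongr

theorem EigenvaluesLt.tendsto_pow {M : Matrix ι ι ℝ} {r : ℝ} (hr : 0 < r)
    (h : EigenvaluesLt M r) : Tendsto (fun k : ℕ => (r⁻¹) ^ k • M ^ k) atTop (𝓝 0) := by
  -- Gelfand's formula is used in a nontrivial algebra, so empty matrices are treated apart.
  rcases isEmpty_or_nonempty ι with hι | hι
  · exact tendsto_const_nhds.congr fun k => Subsingleton.elim _ _
  have h1 := tendsto_inv_smul_pow_of_spectrum_lt _ hr h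
  have h2 : Tendsto (fun k : ℕ => ((r⁻¹ : ℝ) ^ k) • (M.map (fun a : ℝ => (a : ℂ))) ^ k)
      atTop (𝓝 0) := by
    rw [tendsto_zero_iff_norm_tendsto_zero]
    refine h1.congr fun k => ?_
    rw [norm_smul, norm_pow (r⁻¹ : ℝ), norm_inv, Real.norm_of_nonneg hr.le]
  refine tendsto_matrix_iff.2 fun i j => ?_
  have h4 := ((Complex.continuous_re.comp (continuous_id.matrix_elem i j)).tendsto _).comp h2
  simp only [Function.comp_def, id, Matrix.zero_apply, Complex.zero_re] at h4
  refine h4.congr fun k => ?_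
  have h5 : (M.map (fun a : ℝ => (a : ℂ))) ^ k = (M ^ k).map (fun a : ℝ => (a : ℂ)) :=
    ((Complex.ofRealHom.mapMatrix).map_pow M k).symm
  rw [h5, Matrix.smul_apply, Matrix.map_apply, Complex.smul_re, Complex.ofReal_re,
    Matrix.smul_apply]

/-- The spectrum is compact, so a strict bound leaves a gap. -/
theorem EigenvaluesLt.exists_lt {M : Matrix ι ι ℝ} {r : ℝ} (hr : 0 < r)
    (h : EigenvaluesLt M r) : ∃ s, 0 < s ∧ s < r ∧ EigenvaluesLt M s := by
  by_cases hne : (spectrum ℂ (M.map (fun a : ℝ => (a : ℂ)))).Nonempty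
  · obtain ⟨μ, hμ, hmax⟩ := (spectrum.isCompact _).exists_isMaxOn hne continuous_norm.continuousOn
    obtain ⟨s, hs1, hs2⟩ := exists_between (h μ hμ)
    exact ⟨s, (norm_nonneg μ).trans_lt hs1, hs2, fun ν hν => (hmax hν).trans_lt hs1⟩
  · exact ⟨r / 2, by linarith, by linarith, fun μ hμ => (hne ⟨μ, hμ⟩).elim⟩

theorem EigenvaluesLt.exists_norm_pow_le {M : Matrix ι ι ℝ} {r : ℝ} (hr : 0 < r)
    (h : EigenvaluesLt M r) : ∃ c, ∀ k, ‖M ^ k‖ ≤ c * r ^ k := by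
  obtain ⟨c, hc⟩ := (h.tendsto_pow hr).norm.bddAbove_range
  refine ⟨c, fun k => ?_⟩
  have := hc ⟨k, rfl⟩
  simp only [norm_smul, norm_pow, norm_inv, Real.norm_of_nonneg hr.le] at this
  rw [inv_pow, inv_mul_le_iff₀ (by positivity)] at this
  linarith

/-- `M * N` and `N * M` have the same nonzero spectrum, and zero satisfies the bound anyway. -/
theorem EigenvaluesLt.mul_comm {M N : Matrix ι ι ℝ} {r : ℝ} (hr : 0 < r)
    (h : EigenvaluesLt (M * N) r) : EigenvaluesLt (N * M) r := by
  intro μ hμ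
  rcases eq_or_ne μ 0 with rfl | h0
  · simpa using hr
  refine h μ ?_
  have hmap : ∀ X Y : Matrix ι ι ℝ, (X * Y).map (fun a : ℝ => (a : ℂ)) =
      X.map (fun a : ℝ => (a : ℂ)) * Y.map (fun a : ℝ => (a : ℂ)) := fun X Y =>
    (Complex.ofRealHom.mapMatrix).map_mul X Y
  rw [hmap] at hμ ⊢
  have := spectrum.nonzero_mul_comm (𝕜 := ℂ) (N.map (fun a : ℝ => (a : ℂ)))
    (M.map (fun a : ℝ => (a : ℂ)))
  have h2 : μ ∈ spectrum ℂ (N.map (fun a : ℝ => (a : ℂ)) * M.map (fun a : ℝ => (a : ℂ))) \ {0} :=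
    ⟨hμ, h0⟩
  rw [this] at h2
  exact h2.1

/-- `(F (j + l - 1)) ⋯ (F j)`. -/
noncomputable def orderedProd {E : Type*} [Monoid E] (F : ℕ → E) (j : ℕ) : ℕ → E
  | 0 => 1
  | l + 1 => F (j + l) * orderedProd F j l

theorem orderedProd_add {E : Type*} [Monoid E] (F : ℕ → E) (j a b : ℕ) :
    orderedProd F j (a + b) = orderedProd F (j + a) b * orderedProd F j a := by
  induction b with
  | zero => simp [orderedProd]
  | succ b ih => rw [← add_assoc, orderedProd, ih, orderedProd, mul_assoc, add_assoc]

theorem tendsto_orderedProd {E : Type*} [NormedRing E] {F : ℕ → E} {a : E}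
    (hF : Tendsto F atTop (𝓝 a)) (l : ℕ) :
    Tendsto (fun j => orderedProd F j l) atTop (𝓝 (a ^ l)) := by
  induction l with
  | zero => simp [orderedProd]
  | succ l ih =>
    rw [pow_succ']
    exact (hF.comp (tendsto_add_atTop_nat l)).mul ih

/-- Products of matrices that converge to `M` decay at every rate above the spectral radius of
`M`, uniformly in the first factor. -/
theorem exists_norm_orderedProd_le {F : ℕ → Matrix ι ι ℝ} {M : Matrix ι ι ℝ} {r : ℝ} (hr : 0 < r)
    (h : EigenvaluesLt M r) (hF : Tendsto F atTop (𝓝 M)) :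
    ∃ c, ∀ j l, ‖orderedProd F j l‖ ≤ c * r ^ l := by
  -- A block length at which the power of `M` beats the rate strictly; by continuity so do all
  -- blocks of this length that start late enough.
  obtain ⟨L, hL⟩ : ∃ L : ℕ, ‖M ^ (L + 1)‖ < r ^ (L + 1) := by
    have h0 : ‖(0 : Matrix ι ι ℝ)‖ < 1 := by simp
    have h1 := ((h.tendsto_pow hr).norm.comp (tendsto_add_atTop_nat 1)).eventually
      (gt_mem_nhds h0)
    obtain ⟨L, hL⟩ := h1.exists
    refine ⟨L, ?_⟩
    simp only [Function.comp, norm_smul, norm_pow, norm_inv, Real.norm_of_nonneg hr.le] at hL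
    rwa [inv_pow, inv_mul_lt_iff₀ (by positivity), mul_one] at hL
  obtain ⟨J, hJ⟩ := eventually_atTop.1
    ((tendsto_orderedProd hF (L + 1)).norm.eventually (gt_mem_nhds hL))
  obtain ⟨b, hb⟩ := hF.norm.bddAbove_range
  set C : ℝ := max 1 (b / r) with hC
  have hC1 : 1 ≤ C := le_max_left _ _
  have hFC : ∀ k, ‖F k‖ ≤ C * r := fun k => by
    have : b / r ≤ C := le_max_right _ _
    rw [div_le_iff₀ hr] at this
    exact (hb ⟨k, rfl⟩).trans this
  have hcrude : ∀ j l, ‖orderedProd F j l‖ ≤ ‖(1 : Matrix ι ι ℝ)‖ * C ^ l * r ^ l := by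
    intro j l
    induction l with
    | zero => simp [orderedProd]
    | succ l ih =>
      calc ‖orderedProd F j (l + 1)‖ ≤ ‖F (j + l)‖ * ‖orderedProd F j l‖ := norm_mul_le _ _
        _ ≤ (C * r) * (‖(1 : Matrix ι ι ℝ)‖ * C ^ l * r ^ l) := by gcongr; exact hFC _
        _ = _ := by ring
  set c₁ : ℝ := ‖(1 : Matrix ι ι ℝ)‖ * C ^ L
  have hc₁ : 0 ≤ c₁ := by positivity
  -- Peel off whole blocks, each costing at most its share of the rate; the remainder, shorter than
  -- a block, is bounded crudely.
  have hlate : ∀ l j, J ≤ j → ‖orderedProd F j l‖ ≤ c₁ * r ^ l := by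
    intro l
    induction l using Nat.strong_induction_on with
    | _ l ih =>
      intro j hj
      rcases lt_or_ge l (L + 1) with hl | hl
      · refine (hcrude j l).trans ?_
        have : C ^ l ≤ C ^ L := pow_le_pow_right₀ hC1 (by omega)
        simp only [c₁]
        gcongr
      · obtain ⟨k, rfl⟩ := Nat.exists_eq_add_of_le hl
        rw [orderedProd_add]
        calc _ ≤ _ := norm_mul_le _ _
          _ ≤ (c₁ * r ^ k) * r ^ (L + 1) :=
            mul_le_mul (ih k (by omega) _ (by omega)) (hJ j hj).le (norm_nonneg _) (by positivity)
          _ = _ := by ring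
  set c₂ : ℝ := ‖(1 : Matrix ι ι ℝ)‖ * C ^ J
  have hc₂ : 0 ≤ c₂ := by positivity
  refine ⟨c₂ + c₁ * c₂, fun j l => ?_⟩
  have hC2 : ∀ i, i ≤ J → ‖(1 : Matrix ι ι ℝ)‖ * C ^ i * r ^ i ≤ c₂ * r ^ i := fun i hi => by
    have : C ^ i ≤ C ^ J := pow_le_pow_right₀ hC1 hi
    simp only [c₂]
    gcongr
  have hrl : 0 ≤ r ^ l := by positivity
  rcases le_total l J with hl | hl
  · nlinarith [(hcrude j l).trans (hC2 l hl), mul_nonneg (mul_nonneg hc₁ hc₂) hrl]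
  · obtain ⟨k, rfl⟩ := Nat.exists_eq_add_of_le hl
    rw [orderedProd_add]
    have h1 := norm_mul_le (orderedProd F (j + J) k) (orderedProd F j J)
    have h2 := mul_le_mul (hlate k (j + J) (by omega)) ((hcrude j J).trans (hC2 J le_rfl))
      (norm_nonneg _) (by positivity)
    have h3 : c₁ * r ^ k * (c₂ * r ^ J) = c₁ * c₂ * r ^ (J + k) := by ring
    nlinarith [mul_nonneg hc₂ hrl]

end PowerRates

/-! ### Monotonicity and convergence of the Riccati recursion. -/

section Riccati

open scoped MatrixOrder

variable {ι κ : Type} [Fintype ι] [DecidableEq ι] [Fintype κ] [DecidableEq κ]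

theorem conj_mono {ι' : Type} [Fintype ι'] {X Y : Matrix ι ι ℝ} (h : X ≤ Y) (F : Matrix ι' ι ℝ) :
    F * X * Fᵀ ≤ F * Y * Fᵀ := by
  rw [Matrix.le_iff] at h ⊢
  have := h.mul_mul_conjTranspose_same F
  rwa [Matrix.conjTranspose_eq_transpose_of_trivial, Matrix.mul_sub, Matrix.sub_mul] at this

theorem conj_nonneg {ι' : Type} [Fintype ι'] {X : Matrix ι ι ℝ} (h : 0 ≤ X) (F : Matrix ι' ι ℝ) :
    0 ≤ F * X * Fᵀ := by
  simpa using conj_mono h F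

theorem transpose_eq_of_nonneg {X : Matrix ι ι ℝ} (h : 0 ≤ X) : Xᵀ = X := by
  have := (Matrix.nonneg_iff_posSemidef.1 h).isHermitian.eq
  rwa [Matrix.conjTranspose_eq_transpose_of_trivial] at this

/-- The Kalman gain for prior covariance `P`. -/
noncomputable def kalmanGain (H : Matrix κ ι ℝ) (R : Matrix κ κ ℝ) (P : Matrix ι ι ℝ) : Matrix ι κ ℝ :=
  P * (Hᵀ * (H * P * Hᵀ + R)⁻¹)

/-- One step of the Riccati recursion for the prior covariance. -/
noncomputable def riccati (Φ : Matrix ι ι ℝ) (H : Matrix κ ι ℝ) (Q : Matrix ι ι ℝ) (R : Matrix κ κ ℝ)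
    (P : Matrix ι ι ℝ) : Matrix ι ι ℝ :=
  Φ * ((1 - kalmanGain H R P * H) * P) * Φᵀ + Q

/-- Prior covariance after one step of a filter with an arbitrary predictor gain `L`. -/
noncomputable def gainCov (Φ : Matrix ι ι ℝ) (H : Matrix κ ι ℝ) (Q : Matrix ι ι ℝ) (R : Matrix κ κ ℝ)
    (L : Matrix ι κ ℝ) (P : Matrix ι ι ℝ) : Matrix ι ι ℝ :=
  (Φ - L * H) * P * (Φ - L * H)ᵀ + (L * R * Lᵀ + Q)

variable {Φ : Matrix ι ι ℝ} {H : Matrix κ ι ℝ} {Q : Matrix ι ι ℝ} {R : Matrix κ κ ℝ}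
  {P P' : Matrix ι ι ℝ}

theorem innovationCov_posDef (H : Matrix κ ι ℝ) (hR : R.PosDef) (hP : 0 ≤ P) :
    (H * P * Hᵀ + R).PosDef :=
  Matrix.PosDef.posSemidef_add (Matrix.nonneg_iff_posSemidef.1 (conj_nonneg hP H)) hR

/-- Completing the square in `L`: the excess over the optimal gain is a nonnegative term, which
makes the Riccati map a minimum over gains. -/
theorem gainCov_eq (Φ : Matrix ι ι ℝ) (H : Matrix κ ι ℝ) (Q : Matrix ι ι ℝ) (hR : R.PosDef)
    (hP : 0 ≤ P) (L : Matrix ι κ ℝ) :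
    gainCov Φ H Q R L P = riccati Φ H Q R P +
      (L - Φ * kalmanGain H R P) * (H * P * Hᵀ + R) * (L - Φ * kalmanGain H R P)ᵀ := by
  have hM := innovationCov_posDef H hR hP
  have hPt := transpose_eq_of_nonneg hP
  set M := H * P * Hᵀ + R with hMdef
  have hMt : Mᵀ = M := by
    have := hM.isHermitian.eq
    rwa [Matrix.conjTranspose_eq_transpose_of_trivial] at this
  have hdet : IsUnit M.det := (Matrix.isUnit_iff_isUnit_det _).1 hM.isUnit
  have hRM : R = M - H * P * Hᵀ := by rw [hMdef]; abel
  have hK : kalmanGain H R P = P * (Hᵀ * M⁻¹) := rfl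
  set K := Φ * kalmanGain H R P with hKdef
  have hKM : K * M = Φ * P * Hᵀ := by
    rw [hKdef, hK]
    simp only [Matrix.mul_assoc]
    rw [Matrix.nonsing_inv_mul _ hdet, Matrix.mul_one]
  have hMK : M * Kᵀ = H * P * Φᵀ := by
    have := congrArg Matrix.transpose hKM
    simpa [Matrix.transpose_mul, hMt, hPt, Matrix.mul_assoc] using this
  have hric : riccati Φ H Q R P = Φ * P * Φᵀ - K * (H * P * Φᵀ) + Q := by
    rw [riccati, hKdef, Matrix.sub_mul, Matrix.one_mul, Matrix.mul_sub, Matrix.sub_mul]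
    simp only [Matrix.mul_assoc]
  rw [hric, gainCov, hRM]
  simp only [Matrix.transpose_sub, Matrix.transpose_mul, Matrix.sub_mul, Matrix.mul_sub]
  have e1 : K * M * Lᵀ = Φ * P * Hᵀ * Lᵀ := by rw [hKM]
  have e2 : L * M * Kᵀ = L * (H * P * Φᵀ) := by rw [Matrix.mul_assoc, hMK]
  have e3 : K * M * Kᵀ = K * (H * P * Φᵀ) := by rw [Matrix.mul_assoc, hMK]
  rw [e1, e2, e3]
  simp only [Matrix.mul_assoc]
  abel

theorem riccati_eq_gainCov (Φ : Matrix ι ι ℝ) (H : Matrix κ ι ℝ) (Q : Matrix ι ι ℝ)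
    (hR : R.PosDef) (hP : 0 ≤ P) :
    riccati Φ H Q R P = gainCov Φ H Q R (Φ * kalmanGain H R P) P := by
  simp [gainCov_eq Φ H Q hR hP]

theorem riccati_le_gainCov (hR : R.PosDef) (hP : 0 ≤ P) (L : Matrix ι κ ℝ) :
    riccati Φ H Q R P ≤ gainCov Φ H Q R L P := by
  rw [gainCov_eq Φ H Q hR hP]
  exact le_add_of_nonneg_right
    (conj_nonneg (innovationCov_posDef H hR hP).posSemidef.nonneg _)

theorem gainCov_mono (L : Matrix ι κ ℝ) (h : P ≤ P') :
    gainCov Φ H Q R L P ≤ gainCov Φ H Q R L P' :=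
  add_le_add_left (conj_mono h _) _

theorem gainCov_noise_nonneg (hR : R.PosDef) (hQ : 0 ≤ Q) (L : Matrix ι κ ℝ) :
    0 ≤ L * R * Lᵀ + Q :=
  add_nonneg (conj_nonneg hR.posSemidef.nonneg L) hQ

/-- The gain optimal for `P'` is merely admissible for `P`, and with a fixed gain the covariance
update is monotone. -/
theorem riccati_mono (hR : R.PosDef) (hP : 0 ≤ P) (h : P ≤ P') :
    riccati Φ H Q R P ≤ riccati Φ H Q R P' := by
  rw [riccati_eq_gainCov Φ H Q hR (hP.trans h)]
  exact (riccati_le_gainCov hR hP _).trans (gainCov_mono _ h)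

theorem riccati_nonneg (hR : R.PosDef) (hQ : 0 ≤ Q) (hP : 0 ≤ P) : 0 ≤ riccati Φ H Q R P := by
  rw [riccati_eq_gainCov Φ H Q hR hP]
  exact add_nonneg (conj_nonneg hP _) (gainCov_noise_nonneg hR hQ _)

theorem riccati_iterate_nonneg (hR : R.PosDef) (hQ : 0 ≤ Q) (hP : 0 ≤ P) (k : ℕ) :
    0 ≤ (riccati Φ H Q R)^[k] P := by
  induction k with
  | zero => simpa
  | succ k ih => rw [Function.iterate_succ_apply']; exact riccati_nonneg hR hQ ih

theorem riccati_iterate_mono (hR : R.PosDef) (hQ : 0 ≤ Q) (hP : 0 ≤ P) (h : P ≤ P') (k : ℕ) :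
    (riccati Φ H Q R)^[k] P ≤ (riccati Φ H Q R)^[k] P' := by
  induction k with
  | zero => simpa
  | succ k ih =>
    rw [Function.iterate_succ_apply', Function.iterate_succ_apply']
    exact riccati_mono hR (riccati_iterate_nonneg hR hQ hP k) ih

theorem monotone_riccati_iterate_zero (hR : R.PosDef) (hQ : 0 ≤ Q) :
    Monotone fun k => (riccati Φ H Q R)^[k] 0 := by
  refine monotone_nat_of_le_succ fun k => ?_
  rw [Function.iterate_succ_apply]
  exact riccati_iterate_mono hR hQ le_rfl (riccati_nonneg hR hQ le_rfl) k

/-- The quadratic form of a symmetric matrix. -/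
noncomputable def quadForm (X : Matrix ι ι ℝ) (v : ι → ℝ) : ℝ := v ⬝ᵥ X *ᵥ v

theorem quadForm_mono {X Y : Matrix ι ι ℝ} (h : X ≤ Y) (v : ι → ℝ) :
    quadForm X v ≤ quadForm Y v := by
  have := (Matrix.le_iff.1 h).dotProduct_mulVec_nonneg v
  simpa [quadForm, Matrix.sub_mulVec] using this

theorem continuous_quadForm (v : ι → ℝ) : Continuous fun X : Matrix ι ι ℝ => quadForm X v :=
  continuous_const.dotProduct (continuous_id.matrix_mulVec continuous_const)

/-- Polarization; it reduces convergence of symmetric matrices to that of scalar quadratic forms. -/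
theorem entry_eq_quadForm {X : Matrix ι ι ℝ} (h : Xᵀ = X) (i j : ι) :
    X i j = (quadForm X (Pi.single i 1 + Pi.single j 1) - quadForm X (Pi.single i 1) -
      quadForm X (Pi.single j 1)) / 2 := by
  have : X j i = X i j := congrFun (congrFun h i) j
  simp [quadForm, Matrix.mulVec_add, this]
  ring

/-- Nonnegative matrices converge if their quadratic forms do. -/
theorem exists_tendsto_of_quadForm {f : ℕ → Matrix ι ι ℝ} (hf : ∀ k, 0 ≤ f k)
    (h : ∀ v, ∃ a, Tendsto (fun k => quadForm (f k) v) atTop (𝓝 a)) :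
    ∃ P, Tendsto f atTop (𝓝 P) := by
  choose q hq using h
  refine ⟨fun i j => (q (Pi.single i 1 + Pi.single j 1) - q (Pi.single i 1) -
      q (Pi.single j 1)) / 2, tendsto_matrix_iff.2 fun i j => ?_⟩
  refine Tendsto.congr (fun k => (entry_eq_quadForm (transpose_eq_of_nonneg (hf k)) i j).symm) ?_
  exact (((hq _).sub (hq _)).sub (hq _)).div_const 2

theorem tendsto_of_quadForm {f : ℕ → Matrix ι ι ℝ} {P : Matrix ι ι ℝ} (hf : ∀ k, 0 ≤ f k)
    (hP : Pᵀ = P) (h : ∀ v, Tendsto (fun k => quadForm (f k) v) atTop (𝓝 (quadForm P v))) :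
    Tendsto f atTop (𝓝 P) := by
  refine tendsto_matrix_iff.2 fun i j => ?_
  rw [entry_eq_quadForm hP]
  refine Tendsto.congr (fun k => (entry_eq_quadForm (transpose_eq_of_nonneg (hf k)) i j).symm) ?_
  exact (((h _).sub (h _)).sub (h _)).div_const 2

theorem nonneg_of_tendsto {f : ℕ → Matrix ι ι ℝ} {P : Matrix ι ι ℝ} (hf : ∀ k, 0 ≤ f k)
    (h : Tendsto f atTop (𝓝 P)) : 0 ≤ P := by
  refine Matrix.nonneg_iff_posSemidef.2 (Matrix.PosSemidef.of_dotProduct_mulVec_nonneg ?_ ?_)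
  · rw [Matrix.IsHermitian, Matrix.conjTranspose_eq_transpose_of_trivial]
    have h1 := (continuous_id.matrix_transpose.tendsto P).comp h
    exact tendsto_nhds_unique (h1.congr fun k => transpose_eq_of_nonneg (hf k)) h
  · intro v
    refine ge_of_tendsto (((continuous_quadForm v).tendsto P).comp h)
      (Eventually.of_forall fun k => ?_)
    simpa [quadForm] using quadForm_mono (hf k) v

/-- A detectable pair keeps the Riccati iterates from zero bounded, hence they converge. -/
theorem exists_tendsto_riccati_iterate_zero (hR : R.PosDef) (hQ : 0 ≤ Q)
    {L : Matrix ι κ ℝ} (hL : EigenvaluesLt (Φ - L * H) 1) :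
    ∃ P, 0 ≤ P ∧ Tendsto (fun k => (riccati Φ H Q R)^[k] 0) atTop (𝓝 P) := by
  set F := Φ - L * H with hF
  set C := L * R * Lᵀ + Q with hC
  have hC0 : 0 ≤ C := gainCov_noise_nonneg hR hQ L
  have hnn := riccati_iterate_nonneg (Φ := Φ) (H := H) hR hQ (le_refl (0 : Matrix ι ι ℝ))
  -- The suboptimal constant gain `L` turns the recursion into a Lyapunov recursion, whose iterates
  -- from zero are these partial sums.
  have hle : ∀ k, (riccati Φ H Q R)^[k] 0 ≤ ∑ i ∈ Finset.range k, F ^ i * C * (F ^ i)ᵀ := by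
    intro k
    induction k with
    | zero => simp
    | succ k ih =>
      rw [Function.iterate_succ_apply', Finset.sum_range_succ']
      refine (riccati_le_gainCov hR (hnn k) L).trans ((gainCov_mono L ih).trans (le_of_eq ?_))
      rw [gainCov, ← hF, ← hC, Finset.mul_sum, Finset.sum_mul]
      simp [pow_succ', Matrix.mul_assoc]
  obtain ⟨s, hs0, hs1, hs⟩ := hL.exists_lt one_pos
  obtain ⟨c, hc⟩ := hs.exists_norm_pow_le hs0
  have hc' : ∀ k, ‖(F ^ k)ᵀ‖ ≤ c * s ^ k := fun k => by
    rw [← Matrix.conjTranspose_eq_transpose_of_trivial, Matrix.l2_opNorm_conjTranspose]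
    exact hc k
  have hsum : Summable fun i => F ^ i * C * (F ^ i)ᵀ := by
    have hg : Summable fun i : ℕ => c * c * ‖C‖ * (s ^ 2) ^ i :=
      (summable_geometric_of_lt_one (by positivity) (by nlinarith)).mul_left _
    refine Summable.of_norm_bounded hg fun i => ?_
    calc ‖F ^ i * C * (F ^ i)ᵀ‖ ≤ ‖F ^ i‖ * ‖C‖ * ‖(F ^ i)ᵀ‖ :=
          (norm_mul_le _ _).trans (by gcongr; exact norm_mul_le _ _)
      _ ≤ (c * s ^ i) * ‖C‖ * (c * s ^ i) := by
          have := hc i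
          have := hc' i
          have := (norm_nonneg _).trans (hc i)
          gcongr
      _ = _ := by ring
  have hlim := hsum.hasSum.tendsto_sum_nat
  obtain ⟨P, hP⟩ := exists_tendsto_of_quadForm hnn fun v => by
    obtain ⟨b, hb⟩ := (((continuous_quadForm v).tendsto _).comp hlim).bddAbove_range
    refine ⟨_, tendsto_atTop_ciSup (fun i j hij =>
      quadForm_mono (monotone_riccati_iterate_zero hR hQ hij) v) ⟨b, ?_⟩⟩
    rintro _ ⟨k, rfl⟩
    exact (quadForm_mono (hle k) v).trans (hb ⟨k, rfl⟩)
  exact ⟨P, nonneg_of_tendsto hnn hP, hP⟩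

theorem continuousAt_innovationInv (H : Matrix κ ι ℝ) (hR : R.PosDef) (hP : 0 ≤ P) :
    ContinuousAt (fun X : Matrix ι ι ℝ => (H * X * Hᵀ + R)⁻¹) P := by
  have hdet : IsUnit (H * P * Hᵀ + R).det :=
    (Matrix.isUnit_iff_isUnit_det _).1 (innovationCov_posDef H hR hP).isUnit
  have h1 : ContinuousAt (fun X : Matrix ι ι ℝ => H * X * Hᵀ + R) P :=
    (((continuous_const.matrix_mul continuous_id).matrix_mul continuous_const).add
      continuous_const).continuousAt
  have h2 : ContinuousAt (Inv.inv : Matrix κ κ ℝ → _) (H * P * Hᵀ + R) :=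
    continuousAt_matrix_inv _ (NormedRing.inverse_continuousAt hdet.unit)
  exact h2.comp_of_eq h1 rfl

theorem continuousAt_kalmanGain (H : Matrix κ ι ℝ) (hR : R.PosDef) (hP : 0 ≤ P) :
    ContinuousAt (kalmanGain H R) P := by
  have h := continuousAt_innovationInv H hR hP
  have h1 : Continuous fun q : Matrix ι ι ℝ × Matrix κ κ ℝ => q.1 * (Hᵀ * q.2) :=
    continuous_fst.matrix_mul (continuous_const.matrix_mul continuous_snd)
  exact h1.continuousAt.comp (f := fun X : Matrix ι ι ℝ => (X, (H * X * Hᵀ + R)⁻¹))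
    (continuousAt_id.prodMk h)

theorem continuousAt_riccati (Φ : Matrix ι ι ℝ) (H : Matrix κ ι ℝ) (Q : Matrix ι ι ℝ)
    (hR : R.PosDef) (hP : 0 ≤ P) : ContinuousAt (riccati Φ H Q R) P := by
  have h1 : Continuous fun q : Matrix ι ι ℝ × Matrix ι κ ℝ =>
      Φ * ((1 - q.2 * H) * q.1) * Φᵀ + Q :=
    ((continuous_const.matrix_mul ((continuous_const.sub
      (continuous_snd.matrix_mul continuous_const)).matrix_mul continuous_fst)).matrix_mul
      continuous_const).add continuous_const
  exact h1.continuousAt.comp (f := fun X : Matrix ι ι ℝ => (X, kalmanGain H R X))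
    (continuousAt_id.prodMk (continuousAt_kalmanGain H hR hP))

/-- If the Riccati iterates from zero converge to a fixed point with a stable closed loop, then so
do the iterates from every nonnegative matrix. -/
theorem tendsto_riccati_iterate (hR : R.PosDef) (hQ : 0 ≤ Q) (hP : 0 ≤ P)
    (h0 : Tendsto (fun k => (riccati Φ H Q R)^[k] 0) atTop (𝓝 P))
    (hfix : riccati Φ H Q R P = P)
    (hF : EigenvaluesLt (Φ - Φ * kalmanGain H R P * H) 1) {X : Matrix ι ι ℝ} (hX : 0 ≤ X) :
    Tendsto (fun k => (riccati Φ H Q R)^[k] X) atTop (𝓝 P) := by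
  set F := Φ - Φ * kalmanGain H R P * H with hFdef
  have hnn := riccati_iterate_nonneg (Φ := Φ) (H := H) hR hQ hX
  -- With the gain frozen at its optimum for `P`, the update is affine with fixed point `P`, so the
  -- deviation is conjugated by `F` at each step.
  have hle : ∀ k, (riccati Φ H Q R)^[k] X ≤ P + F ^ k * (X - P) * (F ^ k)ᵀ := by
    intro k
    induction k with
    | zero => simp
    | succ k ih =>
      rw [Function.iterate_succ_apply']
      refine (riccati_le_gainCov hR (hnn k) (Φ * kalmanGain H R P)).trans
        ((gainCov_mono _ ih).trans (le_of_eq ?_))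
      have h1 := riccati_eq_gainCov Φ H Q hR hP
      rw [hfix] at h1
      simp only [gainCov, ← hFdef] at h1 ⊢
      -- Hides the `P` inside the deviation, since the next rewrite expands every visible `P` on the
      -- right.
      generalize X - P = D
      conv_rhs => rw [h1]
      simp only [pow_succ', Matrix.mul_add, Matrix.add_mul, Matrix.transpose_mul,
        Matrix.mul_assoc]
      abel
  have hpow : Tendsto (fun k => F ^ k) atTop (𝓝 0) := by
    simpa using hF.tendsto_pow one_pos
  have hup : Tendsto (fun k => P + F ^ k * (X - P) * (F ^ k)ᵀ) atTop (𝓝 P) := by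
    have h1 : Continuous fun Y : Matrix ι ι ℝ => P + Y * (X - P) * Yᵀ :=
      continuous_const.add
        ((continuous_id.matrix_mul continuous_const).matrix_mul continuous_id.matrix_transpose)
    have h2 := (h1.tendsto 0).comp hpow
    simp only [Matrix.zero_mul, add_zero] at h2
    exact h2
  refine tendsto_of_quadForm hnn (transpose_eq_of_nonneg hP) fun v => ?_
  exact tendsto_of_tendsto_of_tendsto_of_le_of_le
    (((continuous_quadForm v).tendsto P).comp h0) (((continuous_quadForm v).tendsto P).comp hup)
    (fun k => quadForm_mono (riccati_iterate_mono hR hQ le_rfl hX k) v)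
    (fun k => quadForm_mono (hle k) v)

end Riccati

/-! ### Stability of the limiting closed loop from controllability. -/

section Stability

open scoped MatrixOrder

variable {ι κ : Type} [Fintype ι] [DecidableEq ι] [Fintype κ] [DecidableEq κ]

/-- The real and imaginary parts of a complex left eigenvector; working with them keeps all
quadratic forms real. -/
theorem exists_real_left_eigenvector {M : Matrix ι ι ℝ} {μ : ℂ}
    (h : μ ∈ spectrum ℂ (M.map (fun a : ℝ => (a : ℂ)))) :
    ∃ a b : ι → ℝ, (a ≠ 0 ∨ b ≠ 0) ∧ a ᵥ* M = μ.re • a - μ.im • b ∧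
      b ᵥ* M = μ.im • a + μ.re • b := by
  rw [spectrum.mem_iff, Matrix.isUnit_iff_isUnit_det, isUnit_iff_ne_zero, not_not] at h
  obtain ⟨v, hv0, hv⟩ := Matrix.exists_vecMul_eq_zero_iff.2 h
  rw [Matrix.vecMul_sub, sub_eq_zero, Algebra.algebraMap_eq_smul_one, Matrix.vecMul_smul,
    Matrix.vecMul_one] at hv
  have hsum : ∀ i, ∑ j, v j * (M j i : ℂ) = μ * v i := fun i => (congrFun hv i).symm
  refine ⟨fun i => (v i).re, fun i => (v i).im, ?_, ?_, ?_⟩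
  · by_contra! hc
    exact hv0 (funext fun i => Complex.ext (congrFun hc.1 i) (congrFun hc.2 i))
  · ext i
    have := congrArg Complex.re (hsum i)
    simpa [Matrix.vecMul, dotProduct] using this
  · ext i
    have := congrArg Complex.im (hsum i)
    simp only [Complex.im_sum, Complex.mul_im, Complex.ofReal_im, Complex.ofReal_re,
      mul_zero, zero_add] at this
    simp only [Matrix.vecMul, dotProduct, Pi.add_apply, Pi.smul_apply, smul_eq_mul]
    linarith

theorem quadForm_vecMul (X F : Matrix ι ι ℝ) (a : ι → ℝ) :
    quadForm X (a ᵥ* F) = quadForm (F * X * Fᵀ) a := by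
  simp only [quadForm, Matrix.dotProduct_mulVec, ← Matrix.vecMul_vecMul]
  rw [← Matrix.dotProduct_mulVec _ Fᵀ a, Matrix.mulVec_transpose]

/-- For `v = a + i b` and `μ = s + i t`, this is the scaling of the Hermitian form of `X` by `|μ|²`
when `v` is replaced by `μ v`. -/
theorem quadForm_add_quadForm_rotate {X : Matrix ι ι ℝ} (hX : Xᵀ = X) (a b : ι → ℝ) (s t : ℝ) :
    quadForm X (s • a - t • b) + quadForm X (t • a + s • b) =
      (s ^ 2 + t ^ 2) * (quadForm X a + quadForm X b) := by
  have hsymm : b ⬝ᵥ X *ᵥ a = a ⬝ᵥ X *ᵥ b := by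
    rw [Matrix.dotProduct_mulVec, dotProduct_comm, ← Matrix.mulVec_transpose, hX]
  simp only [quadForm, Matrix.mulVec_add, Matrix.mulVec_sub, Matrix.mulVec_smul, dotProduct_add,
    dotProduct_sub, add_dotProduct, sub_dotProduct, smul_dotProduct, dotProduct_smul, smul_eq_mul,
    hsymm]
  ring

/-- A fixed point of the Riccati recursion has a stable closed loop if no mode of `Φ` is
unreachable from the process noise. -/
theorem eigenvaluesLt_one_of_riccati_fixed {Φ : Matrix ι ι ℝ} {H : Matrix κ ι ℝ}
    {Q : Matrix ι ι ℝ} {R : Matrix κ κ ℝ} {P : Matrix ι ι ℝ}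
    (hR : R.PosDef) (hQ : 0 ≤ Q) (hP : 0 ≤ P) (hfix : riccati Φ H Q R P = P)
    (hreach : ∀ (s t : ℝ) (a b : ι → ℝ), a ᵥ* Φ = s • a - t • b → b ᵥ* Φ = t • a + s • b →
      Q *ᵥ a = 0 → Q *ᵥ b = 0 → a = 0 ∧ b = 0) :
    EigenvaluesLt (Φ - Φ * kalmanGain H R P * H) 1 := by
  intro μ hμ
  by_contra! hμ1
  set K := Φ * kalmanGain H R P with hK
  set F := Φ - K * H with hF
  obtain ⟨a, b, hne, ha, hb⟩ := exists_real_left_eigenvector hμ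
  have hKRK : 0 ≤ K * R * Kᵀ := conj_nonneg hR.posSemidef.nonneg K
  -- The fixed-point equation as an energy balance: what `F` carries over plus measurement and
  -- process noise.
  have hq : ∀ v, quadForm P v =
      quadForm P (v ᵥ* F) + (quadForm R (v ᵥ* K) + quadForm Q v) := by
    intro v
    have h1 := riccati_eq_gainCov Φ H Q hR hP
    rw [hfix, gainCov, ← hK, ← hF] at h1
    rw [quadForm_vecMul, quadForm, quadForm, quadForm, quadForm]
    conv_lhs => rw [h1]
    have h2 : v ᵥ* K ⬝ᵥ R *ᵥ v ᵥ* K = v ⬝ᵥ (K * R * Kᵀ) *ᵥ v := by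
      simp only [Matrix.dotProduct_mulVec, ← Matrix.vecMul_vecMul]
      rw [← Matrix.dotProduct_mulVec _ Kᵀ v, Matrix.mulVec_transpose]
    rw [h2]
    simp only [Matrix.add_mulVec, dotProduct_add]
  have hnn : ∀ {X : Matrix ι ι ℝ}, 0 ≤ X → ∀ v, 0 ≤ quadForm X v := fun h v => by
    simpa [quadForm] using quadForm_mono h v
  have hnnR : ∀ v, 0 ≤ quadForm R v := fun v => by
    simpa [quadForm] using quadForm_mono hR.posSemidef.nonneg v
  have hrot := quadForm_add_quadForm_rotate (transpose_eq_of_nonneg hP) a b μ.re μ.im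
  rw [← ha, ← hb] at hrot
  have hnorm : 1 ≤ μ.re ^ 2 + μ.im ^ 2 := by
    have : ‖μ‖ ^ 2 = μ.re ^ 2 + μ.im ^ 2 := by
      rw [Complex.sq_norm, Complex.normSq_apply]; ring
    nlinarith
  have hs : quadForm P a + quadForm P b ≤
      (μ.re ^ 2 + μ.im ^ 2) * (quadForm P a + quadForm P b) :=
    le_mul_of_one_le_left (add_nonneg (hnn hP a) (hnn hP b)) hnorm
  -- As `|μ| ≥ 1`, the carried part, summed over `a` and `b`, already exhausts the balance, so the
  -- noise terms are zero. Then `v ᵥ* K = 0`, and `F` acts on `v` as `Φ` does.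
  have hzero : ∀ v, quadForm R (v ᵥ* K) + quadForm Q v = 0 → v ᵥ* K = 0 ∧ Q *ᵥ v = 0 := by
    intro v hv
    have h1 := hnnR (v ᵥ* K)
    have h2 := hnn hQ v
    constructor
    · by_contra hne
      have := hR.dotProduct_mulVec_pos hne
      simp only [star_trivial] at this
      change 0 < quadForm R (v ᵥ* K) at this
      linarith
    · refine ((Matrix.nonneg_iff_posSemidef.1 hQ).dotProduct_mulVec_zero_iff v).1 ?_
      simp only [star_trivial]
      change quadForm Q v = 0
      linarith
  have h1 := hq a
  have h2 := hq b
  have h3 := hnnR (a ᵥ* K)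
  have h4 := hnnR (b ᵥ* K)
  have h5 := hnn hQ a
  have h6 := hnn hQ b
  obtain ⟨ha1, ha2⟩ := hzero a (by linarith)
  obtain ⟨hb1, hb2⟩ := hzero b (by linarith)
  have hΦ : ∀ v : ι → ℝ, v ᵥ* K = 0 → v ᵥ* Φ = v ᵥ* F := fun v hv => by
    rw [hF, Matrix.vecMul_sub, ← Matrix.vecMul_vecMul, hv, Matrix.zero_vecMul, sub_zero]
  have := hreach μ.re μ.im a b ((hΦ a ha1).trans ha) ((hΦ b hb1).trans hb) ha2 hb2
  rcases hne with h | h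
  · exact h this.1
  · exact h this.2

theorem IsControllable.eq_zero {n m : ℕ} {A : Matrix (Fin n) (Fin n) ℝ}
    {B : Matrix (Fin n) (Fin m) ℝ} (h : IsControllable A B) {a : Fin n → ℝ}
    (ha : ∀ k, a ᵥ* (A ^ k * B) = 0) : a = 0 := by
  set C := Matrix.of fun (i : Fin n) (kj : Fin n × Fin m) => (A ^ (kj.1 : ℕ) * B) i kj.2 with hC
  have hrank : C.rank = n := h
  have hli : LinearIndependent ℝ C.row := by
    rw [linearIndependent_iff_card_eq_finrank_span, Set.finrank,
      ← Matrix.rank_eq_finrank_span_row, hrank, Fintype.card_fin]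
  refine Matrix.vecMul_injective_iff.2 hli ?_
  ext kj
  simpa [hC, Matrix.vecMul, dotProduct] using congrFun (ha kj.1) kj.2

/-- One half of the Hautus test, in real form: the vectors that `A ^ k` produces from `a` and `b`
stay in their span, which `B` annihilates. -/
theorem IsControllable.eq_zero_of_invariant {n m : ℕ} {A : Matrix (Fin n) (Fin n) ℝ}
    {B : Matrix (Fin n) (Fin m) ℝ} (h : IsControllable A B) {s t : ℝ} {a b : Fin n → ℝ}
    (ha : a ᵥ* A = s • a - t • b) (hb : b ᵥ* A = t • a + s • b)
    (haB : a ᵥ* B = 0) (hbB : b ᵥ* B = 0) : a = 0 ∧ b = 0 := by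
  have key : ∀ k, a ᵥ* (A ^ k * B) = 0 ∧ b ᵥ* (A ^ k * B) = 0 := by
    intro k
    induction k with
    | zero => simpa using ⟨haB, hbB⟩
    | succ k ih =>
      simp only [pow_succ', Matrix.mul_assoc A, ← Matrix.vecMul_vecMul _ A, ha, hb,
        Matrix.add_vecMul, Matrix.sub_vecMul, Matrix.smul_vecMul, ih]
      simp
  exact ⟨h.eq_zero fun k => (key k).1, h.eq_zero fun k => (key k).2⟩

end Stability

/-! ### Convergence of the Kalman filter and its gain bounds. -/

namespace TrackingProblem

open scoped MatrixOrder

variable {n m p : ℕ} (T : TrackingProblem n m p)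

theorem Rn_posDef (hW : T.W.PosDef) : T.Rn.PosDef := hW.inv

theorem Qn_nonneg (hV : T.V.PosDef) : 0 ≤ T.Qn := by
  have h := conj_nonneg hV.inv.posSemidef.nonneg
    (Matrix.fromRows 0 1 : Matrix (Fin n ⊕ Fin m) (Fin m) ℝ)
  convert h using 1
  rw [Matrix.transpose_fromRows, Matrix.fromRows_mul, Matrix.fromRows_mul_fromCols]
  simp [Qn]

/-- Since `V⁻¹` is invertible, the kernel of `Qn` consists of vectors without control component. For
these the upper blocks of `Phi` give an invariant pair of `A` annihilated by `B`. -/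
theorem Phi_reachable (hV : T.V.PosDef) (hcontr : IsControllable T.A T.B) (s t : ℝ)
    (a b : Fin n ⊕ Fin m → ℝ) (ha : a ᵥ* T.Phi = s • a - t • b)
    (hb : b ᵥ* T.Phi = t • a + s • b) (haQ : T.Qn *ᵥ a = 0) (hbQ : T.Qn *ᵥ b = 0) :
    a = 0 ∧ b = 0 := by
  have hinr : ∀ v : Fin n ⊕ Fin m → ℝ, T.Qn *ᵥ v = 0 → v ∘ Sum.inr = 0 := by
    intro v hv
    have h1 : T.V⁻¹ *ᵥ (v ∘ Sum.inr) = 0 := by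
      ext j
      have := congrFun hv (Sum.inr j)
      simpa [Qn, Matrix.fromBlocks_mulVec] using this
    have h2 : T.V *ᵥ (T.V⁻¹ *ᵥ (v ∘ Sum.inr)) = 0 := by rw [h1, Matrix.mulVec_zero]
    rwa [Matrix.mulVec_mulVec, Matrix.mul_nonsing_inv _
      ((Matrix.isUnit_iff_isUnit_det _).1 hV.isUnit), Matrix.one_mulVec] at h2
  have ha0 := hinr a haQ
  have hb0 := hinr b hbQ
  have hl : ∀ v : Fin n ⊕ Fin m → ℝ, v ∘ Sum.inr = 0 →
      v ᵥ* T.Phi = Sum.elim ((v ∘ Sum.inl) ᵥ* T.A) ((v ∘ Sum.inl) ᵥ* T.B) := by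
    intro v hv
    rw [Phi, Matrix.vecMul_fromBlocks, hv]
    simp
  rw [hl a ha0] at ha
  rw [hl b hb0] at hb
  have key := hcontr.eq_zero_of_invariant (s := s) (t := t) (a := a ∘ Sum.inl) (b := b ∘ Sum.inl)
    (by ext i; simpa using congrFun ha (Sum.inl i)) (by ext i; simpa using congrFun hb (Sum.inl i))
    (by ext i; simpa [show a (Sum.inr i) = 0 from congrFun ha0 i,
      show b (Sum.inr i) = 0 from congrFun hb0 i] using congrFun ha (Sum.inr i))
    (by ext i; simpa [show a (Sum.inr i) = 0 from congrFun ha0 i,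
      show b (Sum.inr i) = 0 from congrFun hb0 i] using congrFun hb (Sum.inr i))
  exact ⟨funext (Sum.rec (congrFun key.1) (congrFun ha0)),
    funext (Sum.rec (congrFun key.2) (congrFun hb0))⟩

/-- The iteration starts at time 1 because `H₀` may differ from `H`. -/
theorem prior_add_one (k : ℕ) :
    T.prior (k + 1) = (riccati T.Phi T.H T.Qn T.Rn)^[k] (T.prior 1) := by
  induction k with
  | zero => rfl
  | succ k ih => rw [Function.iterate_succ_apply', ← ih]; rfl

theorem prior_one_nonneg (hW : T.W.PosDef) (hV : T.V.PosDef) : 0 ≤ T.prior 1 :=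
  riccati_nonneg (H := T.H₀) (T.Rn_posDef hW) (T.Qn_nonneg hV) (T.Qn_nonneg hV)

/-- The prior covariances of the filter converge, and the limiting closed loop is stable. -/
theorem exists_tendsto_prior (hW : T.W.PosDef) (hV : T.V.PosDef)
    (hcontr : IsControllable T.A T.B) (hdet : IsDetectable T.Phi T.H) :
    ∃ P, 0 ≤ P ∧ Tendsto T.prior atTop (𝓝 P) ∧ EigenvaluesLt (T.closedLoop P) 1 := by
  have hR := T.Rn_posDef hW
  have hQ := T.Qn_nonneg hV
  obtain ⟨L, hL⟩ := hdet
  obtain ⟨P, hP, hlim⟩ := exists_tendsto_riccati_iterate_zero hR hQ hL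
  have hfix : riccati T.Phi T.H T.Qn T.Rn P = P := by
    have h1 := ((continuousAt_riccati T.Phi T.H T.Qn hR hP).tendsto).comp hlim
    have h2 := hlim.comp (tendsto_add_atTop_nat 1)
    refine tendsto_nhds_unique h1 (h2.congr fun k => ?_)
    exact Function.iterate_succ_apply' _ _ _
  have hF := eigenvaluesLt_one_of_riccati_fixed hR hQ hP hfix (T.Phi_reachable hV hcontr)
  refine ⟨P, hP, ?_, ?_⟩
  · refine (tendsto_add_atTop_iff_nat 1).1 ?_
    refine (tendsto_riccati_iterate hR hQ hP hlim hfix hF (T.prior_one_nonneg hW hV)).congr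
      fun k => (T.prior_add_one k).symm
  -- The predictor form is `Φ (I - K H)` and the filter form `(I - K H) Φ`; swapping the factors
  -- keeps the nonzero spectrum.
  · have h1 : T.Phi - T.Phi * kalmanGain T.H T.Rn P * T.H =
        T.Phi * (1 - kalmanGain T.H T.Rn P * T.H) := by
      rw [Matrix.mul_sub, Matrix.mul_one, Matrix.mul_assoc]
    rw [h1] at hF
    exact hF.mul_comm one_pos

theorem transition_eq_orderedProd (j l : ℕ) : T.transition (j + 1) l =
    orderedProd (fun k => T.closedLoop (T.prior (k + 1))) j l := by
  induction l with
  | zero => rfl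
  | succ l ih =>
    rw [transition, ih, orderedProd, show j + 1 + l = j + l + 1 by omega]
    rfl

/-- Every rate above the spectral radius of the limiting closed loop is attained. -/
theorem exists_gainBounds (hW : T.W.PosDef) {P : Matrix (Fin n ⊕ Fin m) (Fin n ⊕ Fin m) ℝ}
    (hP : 0 ≤ P) (hlim : Tendsto T.prior atTop (𝓝 P)) {r : ℝ} (hr : 0 < r)
    (h : EigenvaluesLt (T.closedLoop P) r) : ∃ c γ₁ γ₂ : ℝ, T.GainBounds r c γ₁ γ₂ := by
  have hR := T.Rn_posDef hW
  have hlim' : Tendsto (fun k => T.prior (k + 1)) atTop (𝓝 P) :=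
    hlim.comp (tendsto_add_atTop_nat 1)
  have hK : Tendsto (fun k => T.K (k + 1)) atTop (𝓝 (kalmanGain T.H T.Rn P)) :=
    (continuousAt_kalmanGain T.H hR hP).tendsto.comp hlim'
  have hS : Tendsto (fun k => T.S (k + 1)) atTop
      (𝓝 (T.Hᵀ * (T.H * P * T.Hᵀ + T.Rn)⁻¹)) := by
    have h1 : Continuous fun X : Matrix (Fin p) (Fin p) ℝ => T.Hᵀ * X :=
      continuous_const.matrix_mul continuous_id
    exact (h1.tendsto _).comp ((continuousAt_innovationInv T.H hR hP).tendsto.comp hlim')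
  have hF : Tendsto (fun k => T.closedLoop (T.prior (k + 1))) atTop (𝓝 (T.closedLoop P)) := by
    have h1 : Continuous fun X : Matrix (Fin n ⊕ Fin m) (Fin p) ℝ => (1 - X * T.H) * T.Phi :=
      (continuous_const.sub (continuous_id.matrix_mul continuous_const)).matrix_mul
        continuous_const
    exact (h1.tendsto _).comp hK
  obtain ⟨c, hc⟩ := exists_norm_orderedProd_le hr h hF
  have hPS : Continuous fun X : Matrix (Fin n ⊕ Fin m) (Fin p) ℝ => T.Phiᵀ * X :=
    continuous_const.matrix_mul continuous_id
  have hPSHP : Continuous fun X : Matrix (Fin n ⊕ Fin m) (Fin p) ℝ => T.Phiᵀ * X * T.H * T.Phi :=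
    (hPS.matrix_mul continuous_const).matrix_mul continuous_const
  obtain ⟨γ, hγ⟩ := ((hPS.tendsto _).comp hS).norm.bddAbove_range
  obtain ⟨g, hg⟩ := ((hPSHP.tendsto _).comp hS).norm.bddAbove_range
  obtain ⟨κ, hκ⟩ := hK.norm.bddAbove_range
  refine ⟨c, γ, g * κ, ⟨?_, ?_, ?_⟩⟩
  · intro j l hj
    obtain ⟨j, rfl⟩ := Nat.exists_eq_add_of_le' hj
    rw [transition_eq_orderedProd]
    exact hc j l
  · intro k hk
    obtain ⟨k, rfl⟩ := Nat.exists_eq_add_of_le' hk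
    exact hγ ⟨k, rfl⟩
  · intro j k hj hk
    obtain ⟨j, rfl⟩ := Nat.exists_eq_add_of_le' hj
    obtain ⟨k, rfl⟩ := Nat.exists_eq_add_of_le' hk
    have h1 : ‖T.Phiᵀ * T.S (j + 1) * T.H * T.Phi‖ ≤ g := hg ⟨j, rfl⟩
    exact mul_le_mul h1 (hκ ⟨k, rfl⟩) (norm_nonneg _) ((norm_nonneg _).trans h1)

end TrackingProblem

/-! ### Matrices acting on Euclidean vectors. -/

section Act

variable {ι κ μ : Type} [Fintype ι] [Fintype κ] [Fintype μ] [DecidableEq ι] [DecidableEq κ]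

theorem act_add (M : Matrix κ ι ℝ) (v w : EuclideanSpace ℝ ι) :
    act M (v + w) = act M v + act M w := by
  ext i; simp [act, Matrix.mulVec_add]

theorem act_sub (M : Matrix κ ι ℝ) (v w : EuclideanSpace ℝ ι) :
    act M (v - w) = act M v - act M w := by
  ext i; simp [act, Matrix.mulVec_sub]

theorem act_zero (M : Matrix κ ι ℝ) : act M 0 = 0 := by
  ext i; simp [act]

theorem act_one (v : EuclideanSpace ℝ ι) : act 1 v = v := by
  ext i; simp [act]

theorem act_act (M : Matrix κ ι ℝ) (N : Matrix ι μ ℝ) (v : EuclideanSpace ℝ μ) :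
    act M (act N v) = act (M * N) v := by
  ext i; simp [act, Matrix.mulVec_mulVec]

theorem sub_act (M N : Matrix κ ι ℝ) (v : EuclideanSpace ℝ ι) :
    act (M - N) v = act M v - act N v := by
  ext i; simp [act, Matrix.sub_mulVec]

theorem act_sum {α : Type*} (M : Matrix κ ι ℝ) (s : Finset α) (v : α → EuclideanSpace ℝ ι) :
    act M (∑ i ∈ s, v i) = ∑ i ∈ s, act M (v i) := by
  classical
  induction s using Finset.induction_on with
  | empty => simp [act_zero]
  | insert a s ha ih => rw [Finset.sum_insert ha, Finset.sum_insert ha, act_add, ih]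

theorem norm_act_le (M : Matrix κ ι ℝ) (v : EuclideanSpace ℝ ι) : ‖act M v‖ ≤ ‖M‖ * ‖v‖ :=
  Matrix.l2_opNorm_mulVec M v

theorem norm_toLp_elim_le (x : EuclideanSpace ℝ ι) (u : EuclideanSpace ℝ κ) :
    ‖(WithLp.toLp 2 (Sum.elim x.ofLp u.ofLp) : EuclideanSpace ℝ (ι ⊕ κ))‖ ≤ ‖x‖ + ‖u‖ := by
  refine le_of_sq_le_sq ?_ (by positivity)
  have h : ‖(WithLp.toLp 2 (Sum.elim x.ofLp u.ofLp) : EuclideanSpace ℝ (ι ⊕ κ))‖ ^ 2 =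
      ‖x‖ ^ 2 + ‖u‖ ^ 2 := by
    simp [EuclideanSpace.norm_sq_eq]
  nlinarith [norm_nonneg x, norm_nonneg u]

end Act

/-! ### Geometric sums with linear weights. -/

section GeometricSums

variable {r : ℝ}

theorem sum_mul_pow_le (h0 : 0 < r) (h1 : r < 1) (J : ℕ) :
    ∑ j ∈ Finset.range J, ((j : ℝ) + 1) * r ^ j ≤ 1 / (1 - r) ^ 2 := by
  have h : (∑ j ∈ Finset.range J, ((j : ℝ) + 1) * r ^ j) * (1 - r) ^ 2 =
      1 - r ^ J - J * r ^ J * (1 - r) := by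
    induction J with
    | zero => simp
    | succ J ih => rw [Finset.sum_range_succ, add_mul, ih]; push_cast; ring
  rw [le_div_iff₀ (by nlinarith), h]
  have : 0 ≤ J * r ^ J * (1 - r) := mul_nonneg (by positivity) (by linarith)
  have : 0 ≤ r ^ J := by positivity
  linarith

/-- The inner convolution satisfies `w (j + 1) = r * w j + (j + 1)`. Hence the whole sum `Σ` obeys
`Σ ≤ r² Σ + r ∑ (j + 1) r ^ j`, and solving for `Σ` produces the factor `1 - r ^ 2`. -/
theorem sum_pow_mul_conv_le (h0 : 0 < r) (h1 : r < 1) (J : ℕ) :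
    ∑ j ∈ Finset.range J, r ^ j * ∑ i ∈ Finset.range j, r ^ (j - 1 - i) * ((i : ℝ) + 1) ≤
      r / ((1 - r ^ 2) * (1 - r) ^ 2) := by
  set w : ℕ → ℝ := fun j => ∑ i ∈ Finset.range j, r ^ (j - 1 - i) * ((i : ℝ) + 1) with hw
  have hw0 : ∀ j, 0 ≤ w j := fun j => Finset.sum_nonneg fun i _ => by positivity
  have hsucc : ∀ j, w (j + 1) = r * w j + (j + 1) := by
    intro j
    simp only [hw]
    rw [Finset.sum_range_succ, Finset.mul_sum]
    congr 1
    · refine Finset.sum_congr rfl fun i hi => ?_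
      rw [Finset.mem_range] at hi
      rw [show j + 1 - 1 - i = j - 1 - i + 1 by omega]
      ring
    · simp
  change ∑ j ∈ Finset.range J, r ^ j * w j ≤ _
  have hX : ∑ j ∈ Finset.range J, r ^ j * w j ≤ ∑ j ∈ Finset.range (J + 1), r ^ j * w j := by
    rw [Finset.sum_range_succ]
    exact le_add_of_nonneg_right (mul_nonneg (by positivity) (hw0 J))
  rw [Finset.sum_range_succ'] at hX
  have hshift : ∑ j ∈ Finset.range J, r ^ (j + 1) * w (j + 1) =
      r ^ 2 * ∑ j ∈ Finset.range J, r ^ j * w j +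
        r * ∑ j ∈ Finset.range J, ((j : ℝ) + 1) * r ^ j := by
    rw [Finset.mul_sum, Finset.mul_sum, ← Finset.sum_add_distrib]
    refine Finset.sum_congr rfl fun j _ => ?_
    rw [hsucc]
    ring
  have hz : w 0 = 0 := by simp [hw]
  rw [hshift, hz, mul_zero, add_zero] at hX
  have h2 : 0 < 1 - r ^ 2 := by nlinarith
  have h3 : 0 < (1 - r) ^ 2 := by nlinarith
  have h4 := mul_le_mul_of_nonneg_left (sum_mul_pow_le h0 h1 J) h0.le
  rw [mul_comm (1 - r ^ 2), ← div_div, le_div_iff₀ h2]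
  have h5 : r * (1 / (1 - r) ^ 2) = r / (1 - r) ^ 2 := by ring
  linarith

theorem summable_add_one_mul_pow (h0 : 0 < r) (h1 : r < 1) :
    Summable fun k : ℕ => ((k : ℝ) + 1) * r ^ k :=
  summable_of_sum_range_le (fun k => by positivity) (sum_mul_pow_le h0 h1)

theorem conv_geometric_le (h0 : 0 < r) (h1 : r < 1) (l : ℕ) :
    ∑ i ∈ Finset.range l, r ^ (l - 1 - i) ≤ (1 - r)⁻¹ := by
  rw [Finset.sum_range_reflect (fun i => r ^ i) l, ← tsum_geometric_of_lt_one h0.le h1]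
  exact (summable_geometric_of_lt_one h0.le h1).sum_le_tsum _ fun i _ => by positivity

end GeometricSums

/-! ### Response of the control to a change of the reference. -/

namespace TrackingProblem

variable {n m p : ℕ} (T : TrackingProblem n m p)

/-- Posterior augmented states of the filter. -/
noncomputable def posterior (x : EuclideanSpace ℝ (Fin n)) (u : EuclideanSpace ℝ (Fin m))
    (z : ℕ → EuclideanSpace ℝ (Fin p)) (k : ℕ) : EuclideanSpace ℝ (Fin n ⊕ Fin m) :=
  T.chi x u z k + act (T.K k) (T.residual x u z k)

/-- The `k`-th summand of the predictive control. -/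
noncomputable def controlTerm (x : EuclideanSpace ℝ (Fin n)) (u : EuclideanSpace ℝ (Fin m))
    (z : ℕ → EuclideanSpace ℝ (Fin p)) (k : ℕ) : EuclideanSpace ℝ (Fin m) :=
  act (T.GPrev k * (T.PhiPrev k)ᵀ * T.S k) (T.residual x u z k)

variable {x : EuclideanSpace ℝ (Fin n)} {u : EuclideanSpace ℝ (Fin m)}
  {z : ℕ → EuclideanSpace ℝ (Fin p)}

theorem chi_succ (k : ℕ) : T.chi x u z (k + 1) = act T.Phi (T.posterior x u z k) := rfl

theorem residual_succ (k : ℕ) : T.residual x u z (k + 1) =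
    z (k + 1) - act (T.H * T.Phi) (T.posterior x u z k) := by
  rw [← act_act]
  rfl

theorem posterior_eq (k : ℕ) : T.posterior x u z k =
    act (1 - T.K k * T.Hk k) (T.chi x u z k) + act (T.K k) (z k) := by
  rw [posterior, residual, act_sub, sub_act, act_one, act_act]
  abel

theorem posterior_succ (k : ℕ) : T.posterior x u z (k + 1) =
    act ((1 - T.K (k + 1) * T.Hk (k + 1)) * T.Phi) (T.posterior x u z k) +
      act (T.K (k + 1)) (z (k + 1)) := by
  rw [posterior_eq, chi_succ, act_act]

theorem transition_zero (j : ℕ) : T.transition j 0 = 1 := rfl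

theorem transition_succ (j l : ℕ) : T.transition j (l + 1) =
    ((1 - T.K (j + l) * T.Hk (j + l)) * T.Phi) * T.transition j l := rfl

/-- Variation of constants: the propagated posterior plus each later input carried forward by the
closed loop. -/
theorem posterior_add (j l : ℕ) : T.posterior x u z (j + l) =
    act (T.transition (j + 1) l) (T.posterior x u z j) +
      ∑ i ∈ Finset.range l,
        act (T.transition (j + i + 2) (l - 1 - i)) (act (T.K (j + 1 + i)) (z (j + 1 + i))) := by
  induction l with
  | zero => simp [transition_zero, act_one]
  | succ l ih =>
    rw [← add_assoc, posterior_succ, ih, act_add, act_act, act_sum, Finset.sum_range_succ,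
      transition_succ, add_assoc]
    simp only [show j + 1 + l = j + l + 1 by omega, add_tsub_cancel_right, tsub_self,
      transition_zero, act_one]
    congr 2
    refine Finset.sum_congr rfl fun i hi => ?_
    rw [Finset.mem_range] at hi
    rw [act_act, show l - i = l - 1 - i + 1 by omega, transition_succ,
      show j + i + 2 + (l - 1 - i) = j + l + 1 by omega]

/-- Transfers closed-loop decay to the accumulated gains. The factor `GPrev 1`, which is `G_0`,
absorbs the exceptional data `H₀` and `Φ_{-1} = I`. -/
theorem GPrev_succ (k : ℕ) : T.GPrev (k + 1) = T.GPrev 1 * (T.transition 1 k)ᵀ := by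
  induction k with
  | zero => simp [transition_zero]
  | succ k ih =>
    rw [GPrev, ih, transition_succ, Matrix.transpose_mul, Matrix.transpose_mul, PhiPrev,
      add_comm 1 k]
    simp only [Matrix.mul_assoc]

theorem control_eq (M : ℕ) : T.control M x u z =
    u + ∑ k ∈ Finset.range (M + 1), T.controlTerm x u z k := rfl

/-- The filter is affine in its data, so common initial data cancel. -/
theorem chi_sub (z' : ℕ → EuclideanSpace ℝ (Fin p)) (k : ℕ) :
    T.chi x u z k - T.chi x u z' k = T.chi 0 0 (z - z') k := by
  induction k with
  | zero =>
    simp only [chi, sub_self]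
    ext i
    rcases i with i | i <;> simp
  | succ k ih =>
    rw [chi_succ, chi_succ, chi_succ, ← act_sub, posterior_eq, posterior_eq, posterior_eq, ← ih,
      act_sub _ (T.chi x u z k), Pi.sub_apply, act_sub _ (z k)]
    congr 1
    abel

theorem residual_sub (z' : ℕ → EuclideanSpace ℝ (Fin p)) (k : ℕ) :
    T.residual x u z k - T.residual x u z' k = T.residual 0 0 (z - z') k := by
  rw [residual, residual, residual, ← chi_sub T z' (x := x) (u := u), act_sub, Pi.sub_apply]
  abel

theorem control_sub (z' : ℕ → EuclideanSpace ℝ (Fin p)) (M : ℕ) :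
    T.control M x u z - T.control M x u z' =
      ∑ k ∈ Finset.range (M + 1), T.controlTerm 0 0 (z - z') k := by
  rw [control_eq, control_eq, add_sub_add_left_eq_sub, ← Finset.sum_sub_distrib]
  refine Finset.sum_congr rfl fun k _ => ?_
  rw [controlTerm, controlTerm, controlTerm, ← residual_sub T z' (x := x) (u := u), act_sub]

variable {T} {r c γ₁ γ₂ : ℝ}

theorem GainBounds.c_nonneg (h : T.GainBounds r c γ₁ γ₂) : 0 ≤ c := by
  simpa using (norm_nonneg _).trans (h.transition_le 1 0 le_rfl)

theorem GainBounds.gain₁_nonneg (h : T.GainBounds r c γ₁ γ₂) : 0 ≤ γ₁ :=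
  (norm_nonneg _).trans (h.gain₁_le 1 le_rfl)

theorem GainBounds.norm_GPrev_le (h : T.GainBounds r c γ₁ γ₂) (k : ℕ) :
    ‖T.GPrev (k + 1)‖ ≤ ‖T.GPrev 1‖ * (c * r ^ k) := by
  rw [GPrev_succ]
  refine (Matrix.l2_opNorm_mul _ _).trans ?_
  rw [← Matrix.conjTranspose_eq_transpose_of_trivial, Matrix.l2_opNorm_conjTranspose]
  gcongr
  exact h.transition_le 1 k le_rfl

theorem posterior_eq_zero {w : ℕ → EuclideanSpace ℝ (Fin p)} {N : ℕ} (hw : ∀ k ≤ N, w k = 0) :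
    ∀ k ≤ N, T.posterior 0 0 w k = 0 := by
  intro k
  induction k with
  | zero =>
    intro hk
    have h0 : T.chi 0 0 w 0 = 0 := by
      ext i
      rcases i with i | i <;> simp [chi]
    rw [posterior_eq, hw 0 hk, h0, act_zero, act_zero, add_zero]
  | succ k ih =>
    intro hk
    rw [posterior_succ, ih (by omega), hw _ hk, act_zero, act_zero, add_zero]

theorem controlTerm_eq_zero {w : ℕ → EuclideanSpace ℝ (Fin p)} {N : ℕ} (hw : ∀ k ≤ N, w k = 0) :
    ∀ k ≤ N, T.controlTerm 0 0 w k = 0 := by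
  intro k hk
  rcases k with _ | k
  · have h0 : T.chi 0 0 w 0 = 0 := by
      ext i
      rcases i with i | i <;> simp [chi]
    rw [controlTerm, residual, h0, hw 0 hk, act_zero, sub_zero, act_zero]
  · rw [controlTerm, residual_succ, posterior_eq_zero hw k (by omega), hw _ hk, act_zero, sub_zero,
      act_zero]

/-- Effect on the control of a reference change that starts after time `N` and grows linearly. -/
theorem GainBounds.norm_controlTerm_le (h : T.GainBounds r c γ₁ γ₂) (hr : 0 < r)
    {w : ℕ → EuclideanSpace ℝ (Fin p)} {N : ℕ} {δ : ℝ} (hw : ∀ k ≤ N, w k = 0)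
    (hgrow : ∀ i : ℕ, ‖w (N + 1 + i)‖ ≤ (i + 1) * δ) (j : ℕ) :
    ‖T.controlTerm 0 0 w (N + 1 + j)‖ ≤ ‖T.GPrev 1‖ * c * r ^ N * δ *
      (γ₁ * ((j + 1) * r ^ j) +
        c * γ₂ * (r ^ j * ∑ i ∈ Finset.range j, r ^ (j - 1 - i) * ((i : ℝ) + 1))) := by
  have hc := h.c_nonneg
  have hidx : N + 1 + j = N + j + 1 := by omega
  have hS : ‖act (T.Phiᵀ * T.S (N + j + 1)) (w (N + j + 1))‖ ≤ γ₁ * ((j + 1) * δ) := by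
    refine (norm_act_le _ _).trans ?_
    have h1 := hgrow j
    rw [hidx] at h1
    exact mul_le_mul (h.gain₁_le _ (by omega)) h1 (norm_nonneg _) h.gain₁_nonneg
  -- The posterior vanishes at time `N`, so only the inputs at `N + 1, …, N + j` enter. Each pairs
  -- the outer gain with its own `K`, at another time, which is why `γ₂` bounds a product over two
  -- indices.
  have hP : ‖act (T.Phiᵀ * T.S (N + j + 1) * T.H * T.Phi) (T.posterior 0 0 w (N + j))‖ ≤
      ∑ i ∈ Finset.range j, γ₂ * (c * (r ^ (j - 1 - i) * ((i + 1) * δ))) := by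
    rw [posterior_add, posterior_eq_zero hw N le_rfl, act_zero, zero_add, act_sum]
    refine (norm_sum_le _ _).trans (Finset.sum_le_sum fun i _ => ?_)
    set X := T.Phiᵀ * T.S (N + j + 1) * T.H * T.Phi
    calc _ ≤ ‖X‖ * (‖T.transition (N + i + 2) (j - 1 - i)‖ *
          (‖T.K (N + 1 + i)‖ * ‖w (N + 1 + i)‖)) :=
          (norm_act_le _ _).trans (mul_le_mul_of_nonneg_left ((norm_act_le _ _).trans
            (mul_le_mul_of_nonneg_left (norm_act_le _ _) (norm_nonneg _))) (norm_nonneg _))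
      _ = (‖X‖ * ‖T.K (N + 1 + i)‖) *
          (‖T.transition (N + i + 2) (j - 1 - i)‖ * ‖w (N + 1 + i)‖) := by ring
      _ ≤ γ₂ * ((c * r ^ (j - 1 - i)) * ((i + 1) * δ)) := by
          have h2 := h.gain₂_le (N + j + 1) (N + 1 + i) (by omega) (by omega)
          refine mul_le_mul h2 (mul_le_mul (h.transition_le _ _ (by omega)) (hgrow i)
            (norm_nonneg _) (by positivity)) (by positivity) ?_
          exact (mul_nonneg (norm_nonneg _) (norm_nonneg _)).trans h2
      _ = _ := by ring
  have hterm : T.controlTerm 0 0 w (N + 1 + j) = act (T.GPrev (N + j + 1))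
      (act (T.Phiᵀ * T.S (N + j + 1)) (w (N + j + 1)) -
        act (T.Phiᵀ * T.S (N + j + 1) * T.H * T.Phi) (T.posterior 0 0 w (N + j))) := by
    rw [hidx, controlTerm, residual_succ, PhiPrev, act_sub, act_sub, act_act, act_act, act_act]
    simp only [Matrix.mul_assoc]
  rw [hterm]
  calc _ ≤ ‖T.GPrev (N + j + 1)‖ * (γ₁ * ((j + 1) * δ) +
        ∑ i ∈ Finset.range j, γ₂ * (c * (r ^ (j - 1 - i) * ((i + 1) * δ)))) :=
        (norm_act_le _ _).trans (mul_le_mul_of_nonneg_left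
          ((norm_sub_le _ _).trans (add_le_add hS hP)) (norm_nonneg _))
    _ ≤ (‖T.GPrev 1‖ * (c * r ^ (N + j))) * (γ₁ * ((j + 1) * δ) +
        ∑ i ∈ Finset.range j, γ₂ * (c * (r ^ (j - 1 - i) * ((i + 1) * δ)))) :=
        mul_le_mul_of_nonneg_right (h.norm_GPrev_le _)
          (add_nonneg ((norm_nonneg _).trans hS) ((norm_nonneg _).trans hP))
    _ = _ := by
      have : ∑ i ∈ Finset.range j, γ₂ * (c * (r ^ (j - 1 - i) * ((i + 1) * δ))) =
          γ₂ * c * δ * ∑ i ∈ Finset.range j, r ^ (j - 1 - i) * ((i : ℝ) + 1) := by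
        rw [Finset.mul_sum]
        exact Finset.sum_congr rfl fun i _ => by ring
      rw [this, pow_add]
      ring

theorem GainBounds.norm_sum_controlTerm_le (h : T.GainBounds r c γ₁ γ₂) (hr : 0 < r) (hr1 : r < 1)
    {w : ℕ → EuclideanSpace ℝ (Fin p)} {N : ℕ} {δ : ℝ} (hδ : 0 ≤ δ) (hw : ∀ k ≤ N, w k = 0)
    (hgrow : ∀ i : ℕ, ‖w (N + 1 + i)‖ ≤ (i + 1) * δ) (J : ℕ) :
    ‖∑ k ∈ Finset.range (N + 1 + J), T.controlTerm 0 0 w k‖ ≤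
      (‖T.GPrev 1‖ * c * (γ₁ / r) * r ^ (N + 1) / (1 - r) ^ 2 +
        ‖T.GPrev 1‖ * c ^ 2 * γ₂ * r ^ (N + 1) / ((1 - r ^ 2) * (1 - r) ^ 2)) * δ := by
  have hc := h.c_nonneg
  have h1 := h.gain₁_nonneg
  have h2 : 0 ≤ γ₂ :=
    (mul_nonneg (norm_nonneg _) (norm_nonneg _)).trans (h.gain₂_le 1 1 le_rfl le_rfl)
  rw [Finset.sum_range_add, Finset.sum_eq_zero fun k hk =>
    controlTerm_eq_zero hw k (by rw [Finset.mem_range] at hk; omega), zero_add]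
  refine (norm_sum_le _ _).trans ((Finset.sum_le_sum fun j _ =>
    h.norm_controlTerm_le hr hw hgrow j).trans ?_)
  rw [← Finset.mul_sum, Finset.sum_add_distrib, ← Finset.mul_sum, ← Finset.mul_sum]
  calc _ ≤ ‖T.GPrev 1‖ * c * r ^ N * δ * (γ₁ * (1 / (1 - r) ^ 2) +
        c * γ₂ * (r / ((1 - r ^ 2) * (1 - r) ^ 2))) := by
        gcongr
        · exact sum_mul_pow_le hr hr1 J
        · exact sum_pow_mul_conv_le hr hr1 J
    _ = _ := by
      -- Only the direct term needs `γ₁ / r`; in the other, the convolution bound supplies the extra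
      -- factor `r`.
      have e : γ₁ / r * r ^ (N + 1) = γ₁ * r ^ N := by
        rw [pow_succ]; field_simp
      rw [mul_assoc _ (γ₁ / r), e]
      ring

end TrackingProblem

/-! ### Summability of the control and tails of the horizon. -/

namespace TrackingProblem

variable {n m p : ℕ} {T : TrackingProblem n m p} {r c γ₁ γ₂ : ℝ}

theorem norm_chi_zero_le (x : EuclideanSpace ℝ (Fin n)) (u : EuclideanSpace ℝ (Fin m))
    (z : ℕ → EuclideanSpace ℝ (Fin p)) : ‖T.chi x u z 0‖ ≤ ‖x‖ + ‖u‖ :=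
  norm_toLp_elim_le x u

theorem norm_residual_zero_le {B : ℝ} {x : EuclideanSpace ℝ (Fin n)}
    {u : EuclideanSpace ℝ (Fin m)} {z : ℕ → EuclideanSpace ℝ (Fin p)} (hxu : ‖x‖ + ‖u‖ ≤ B)
    (hz : ‖z 0‖ ≤ B) : ‖T.residual x u z 0‖ ≤ (1 + ‖T.Hk 0‖) * B := by
  have h1 := (norm_chi_zero_le (T := T) x u z).trans hxu
  calc ‖T.residual x u z 0‖ ≤ ‖z 0‖ + ‖T.Hk 0‖ * ‖T.chi x u z 0‖ :=
        (norm_sub_le _ _).trans (add_le_add_right (norm_act_le _ _) _)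
    _ ≤ B + ‖T.Hk 0‖ * B := by gcongr
    _ = _ := by ring

/-- Inputs up to time `l` are at most `B * (l + 1)` and closed-loop products are summable, so linear
growth passes to the state. Linearity in `B` makes later bounds uniform in the data. -/
theorem GainBounds.norm_posterior_le (h : T.GainBounds r c γ₁ γ₂) (hr : 0 < r) (hr1 : r < 1)
    {κ : ℝ} (hκ : ∀ k, ‖T.K k‖ ≤ κ) {B : ℝ} {x : EuclideanSpace ℝ (Fin n)}
    {u : EuclideanSpace ℝ (Fin m)} {z : ℕ → EuclideanSpace ℝ (Fin p)} (hxu : ‖x‖ + ‖u‖ ≤ B)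
    (hz : ∀ k : ℕ, ‖z k‖ ≤ B * (k + 1)) (l : ℕ) :
    ‖T.posterior x u z l‖ ≤
      (c * (1 + κ * (1 + ‖T.Hk 0‖)) + c * κ * (1 - r)⁻¹) * (B * (l + 1)) := by
  have hc := h.c_nonneg
  have hκ0 : 0 ≤ κ := (norm_nonneg _).trans (hκ 0)
  have hB : 0 ≤ B := (add_nonneg (norm_nonneg _) (norm_nonneg _)).trans hxu
  have hp0 : ‖T.posterior x u z 0‖ ≤ (1 + κ * (1 + ‖T.Hk 0‖)) * B := by
    calc ‖T.posterior x u z 0‖ ≤ ‖T.chi x u z 0‖ + ‖T.K 0‖ * ‖T.residual x u z 0‖ :=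
          (norm_add_le _ _).trans (add_le_add_right (norm_act_le _ _) _)
      _ ≤ B + κ * ((1 + ‖T.Hk 0‖) * B) := by
          have h1 := (norm_chi_zero_le (T := T) x u z).trans hxu
          have h2 := norm_residual_zero_le (T := T) hxu (by simpa using hz 0)
          have h3 := hκ 0
          gcongr
      _ = _ := by ring
  have hfirst : ‖act (T.transition 1 l) (T.posterior x u z 0)‖ ≤
      c * ((1 + κ * (1 + ‖T.Hk 0‖)) * B) * (l + 1) := by
    have h1 : ‖T.transition 1 l‖ ≤ c := (h.transition_le 1 l le_rfl).trans
      (mul_le_of_le_one_right hc (pow_le_one₀ hr.le hr1.le))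
    calc _ ≤ c * ((1 + κ * (1 + ‖T.Hk 0‖)) * B) :=
          (norm_act_le _ _).trans (mul_le_mul h1 hp0 (norm_nonneg _) hc)
      _ ≤ _ := le_mul_of_one_le_right (by positivity) (by linarith [(l.cast_nonneg : (0:ℝ) ≤ l)])
  have hsum : ‖∑ i ∈ Finset.range l, act (T.transition (0 + i + 2) (l - 1 - i))
      (act (T.K (0 + 1 + i)) (z (0 + 1 + i)))‖ ≤ c * κ * (1 - r)⁻¹ * (B * (l + 1)) := by
    calc _ ≤ ∑ i ∈ Finset.range l, r ^ (l - 1 - i) * (c * κ * (B * (l + 1))) := by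
          refine (norm_sum_le _ _).trans (Finset.sum_le_sum fun i hi => ?_)
          rw [Finset.mem_range] at hi
          have h1 : ‖z (0 + 1 + i)‖ ≤ B * (l + 1) := by
            refine (hz _).trans (mul_le_mul_of_nonneg_left ?_ hB)
            exact_mod_cast (by omega : 0 + 1 + i + 1 ≤ l + 1)
          have h2 := hκ (0 + 1 + i)
          have h3 := h.transition_le (0 + i + 2) (l - 1 - i) (by omega)
          calc _ ≤ ‖T.transition (0 + i + 2) (l - 1 - i)‖ *
                (‖T.K (0 + 1 + i)‖ * ‖z (0 + 1 + i)‖) :=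
                (norm_act_le _ _).trans
                  (mul_le_mul_of_nonneg_left (norm_act_le _ _) (norm_nonneg _))
            _ ≤ (c * r ^ (l - 1 - i)) * (κ * (B * (l + 1))) := by gcongr
            _ = _ := by ring
      _ ≤ (1 - r)⁻¹ * (c * κ * (B * (l + 1))) := by
          rw [← Finset.sum_mul]
          exact mul_le_mul_of_nonneg_right (conv_geometric_le hr hr1 l) (by positivity)
      _ = _ := by ring
  have hadd := posterior_add T (x := x) (u := u) (z := z) 0 l
  rw [zero_add l] at hadd
  rw [hadd]
  refine (norm_add_le _ _).trans ((add_le_add hfirst hsum).trans (le_of_eq ?_))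
  ring

/-- The summands of the control decay geometrically, up to a linear factor, along references that
grow at most linearly. -/
theorem GainBounds.exists_norm_controlTerm_le (h : T.GainBounds r c γ₁ γ₂) (hr : 0 < r)
    (hr1 : r < 1) {κ : ℝ} (hκ : ∀ k, ‖T.K k‖ ≤ κ) :
    ∃ D, ∀ (B : ℝ) (x : EuclideanSpace ℝ (Fin n)) (u : EuclideanSpace ℝ (Fin m))
      (z : ℕ → EuclideanSpace ℝ (Fin p)), ‖x‖ + ‖u‖ ≤ B → (∀ k : ℕ, ‖z k‖ ≤ B * (k + 1)) →
      ∀ k, ‖T.controlTerm x u z k‖ ≤ D * B * (((k : ℝ) + 1) * r ^ k) := by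
  have hc := h.c_nonneg
  have hγ := h.gain₁_nonneg
  have hκ0 : 0 ≤ κ := (norm_nonneg _).trans (hκ 0)
  have hr2 : 0 < 1 - r := by linarith
  set E := c * (1 + κ * (1 + ‖T.Hk 0‖)) + c * κ * (1 - r)⁻¹ with hE
  have hE0 : 0 ≤ E := by positivity
  -- `D₀` serves the term at time 0 and `D₁` the later ones; the division by `r` in `D₁` makes up
  -- for `GPrev (k + 1)` decaying only as `r ^ k`.
  set D₀ := ‖T.GPrev 0 * (T.PhiPrev 0)ᵀ * T.S 0‖ * (1 + ‖T.Hk 0‖) with hD₀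
  set D₁ := ‖T.GPrev 1‖ * c * γ₁ * (1 + ‖T.H * T.Phi‖ * E) / r with hD₁
  refine ⟨D₀ + D₁, fun B x u z hxu hz k => ?_⟩
  have hB : 0 ≤ B := (add_nonneg (norm_nonneg _) (norm_nonneg _)).trans hxu
  have hD₀0 : 0 ≤ D₀ := by positivity
  have hD₁0 : 0 ≤ D₁ := by positivity
  rcases k with _ | k
  · calc ‖T.controlTerm x u z 0‖
        ≤ ‖T.GPrev 0 * (T.PhiPrev 0)ᵀ * T.S 0‖ * ((1 + ‖T.Hk 0‖) * B) :=
          (norm_act_le _ _).trans (mul_le_mul_of_nonneg_left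
            (norm_residual_zero_le hxu (by simpa using hz 0)) (norm_nonneg _))
      _ = D₀ * B := by rw [hD₀]; ring
      _ ≤ (D₀ + D₁) * B := by gcongr; linarith
      _ = _ := by simp
  · have hres : ‖T.residual x u z (k + 1)‖ ≤ (1 + ‖T.H * T.Phi‖ * E) * (B * (k + 2)) := by
      rw [residual_succ]
      have h1 := hz (k + 1)
      push_cast at h1
      have h2 := h.norm_posterior_le hr hr1 hκ hxu hz k
      calc _ ≤ ‖z (k + 1)‖ + ‖T.H * T.Phi‖ * ‖T.posterior x u z k‖ :=
            (norm_sub_le _ _).trans (add_le_add_right (norm_act_le _ _) _)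
        _ ≤ B * (k + 1 + 1) + ‖T.H * T.Phi‖ * (E * (B * (k + 2))) := by
            refine add_le_add h1 (mul_le_mul_of_nonneg_left (h2.trans ?_) (norm_nonneg _))
            gcongr
            norm_num
        _ = _ := by ring
    have hgain : ‖T.GPrev (k + 1) * (T.PhiPrev (k + 1))ᵀ * T.S (k + 1)‖ ≤
        (‖T.GPrev 1‖ * (c * r ^ k)) * γ₁ := by
      rw [Matrix.mul_assoc]
      exact (Matrix.l2_opNorm_mul _ _).trans (mul_le_mul (h.norm_GPrev_le k)
        (h.gain₁_le (k + 1) (by omega)) (norm_nonneg _) (by positivity))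
    calc _ ≤ (‖T.GPrev 1‖ * (c * r ^ k)) * γ₁ * ((1 + ‖T.H * T.Phi‖ * E) * (B * (k + 2))) :=
          (norm_act_le _ _).trans (mul_le_mul hgain hres (norm_nonneg _) (by positivity))
      _ = D₁ * B * ((k + 2) * r ^ (k + 1)) := by
          rw [hD₁, pow_succ]
          field_simp
      _ ≤ (D₀ + D₁) * B * ((k + 2) * r ^ (k + 1)) := by gcongr; linarith
      _ = _ := by push_cast; ring

/-- The sum over the first `N + 1` values dominates each of them, so the uncontrolled initial
stretch costs only a constant. -/
theorem norm_le_of_increments {z : ℕ → EuclideanSpace ℝ (Fin p)} {δ : ℝ} {N : ℕ} (hδ : 0 ≤ δ)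
    (hz : ∀ k, N < k → ‖z k - z (k - 1)‖ ≤ δ) (k : ℕ) :
    ‖z k‖ ≤ (∑ i ∈ Finset.range (N + 1), ‖z i‖) + k * δ := by
  induction k with
  | zero =>
    simpa using Finset.single_le_sum (f := fun i => ‖z i‖) (fun i _ => norm_nonneg _)
      (Finset.mem_range.2 N.succ_pos)
  | succ k ih =>
    rcases le_or_gt (k + 1) N with hk | hk
    · exact (Finset.single_le_sum (f := fun i => ‖z i‖) (fun i _ => norm_nonneg _)
        (Finset.mem_range.2 (by omega))).trans (le_add_of_nonneg_right (by positivity))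
    · have h1 := hz (k + 1) hk
      rw [add_tsub_cancel_right] at h1
      have h2 := norm_le_norm_add_norm_sub (z k) (z (k + 1))
      rw [norm_sub_rev] at h2
      push_cast
      linarith

theorem norm_sub_min_le {z : ℕ → EuclideanSpace ℝ (Fin p)} {δ : ℝ} {N : ℕ}
    (hz : ∀ k, N < k → ‖z k - z (k - 1)‖ ≤ δ) (i : ℕ) :
    ‖z (N + 1 + i) - z (min (N + 1 + i) N)‖ ≤ (i + 1) * δ := by
  rw [min_eq_right (by omega)]
  induction i with
  | zero => simpa using hz (N + 1) (by omega)
  | succ i ih =>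
    have h1 := hz (N + 1 + (i + 1)) (by omega)
    rw [show N + 1 + (i + 1) - 1 = N + 1 + i by omega] at h1
    have h2 := norm_sub_le_norm_sub_add_norm_sub (z (N + 1 + (i + 1))) (z (N + 1 + i)) (z N)
    push_cast
    linarith

theorem summable_controlTerm {D B : ℝ} (hr : 0 < r) (hr1 : r < 1)
    {x : EuclideanSpace ℝ (Fin n)} {u : EuclideanSpace ℝ (Fin m)}
    {z : ℕ → EuclideanSpace ℝ (Fin p)}
    (h : ∀ k : ℕ, ‖T.controlTerm x u z k‖ ≤ D * B * (((k : ℝ) + 1) * r ^ k)) :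
    Summable (T.controlTerm x u z) :=
  Summable.of_norm_bounded ((summable_add_one_mul_pow hr hr1).mul_left _) h

theorem tendsto_control {x : EuclideanSpace ℝ (Fin n)} {u : EuclideanSpace ℝ (Fin m)}
    {z : ℕ → EuclideanSpace ℝ (Fin p)} (h : Summable (T.controlTerm x u z)) :
    Tendsto (fun M => T.control M x u z) atTop (𝓝 (u + ∑' k, T.controlTerm x u z k)) :=
  tendsto_const_nhds.add (h.hasSum.tendsto_sum_nat.comp (tendsto_add_atTop_nat 1))

theorem norm_controlInf_sub_control_le {D B : ℝ} (hr : 0 < r) (hr1 : r < 1)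
    {x : EuclideanSpace ℝ (Fin n)} {u : EuclideanSpace ℝ (Fin m)}
    {z : ℕ → EuclideanSpace ℝ (Fin p)}
    (h : ∀ k : ℕ, ‖T.controlTerm x u z k‖ ≤ D * B * (((k : ℝ) + 1) * r ^ k)) (N : ℕ) :
    ‖T.controlInf x u z - T.control N x u z‖ ≤
      ∑' k : ℕ, D * B * (((k + (N + 1) : ℕ) + 1 : ℝ) * r ^ (k + (N + 1))) := by
  have hs := summable_controlTerm hr hr1 h
  have hlim : T.controlInf x u z = u + ∑' k, T.controlTerm x u z k := (tendsto_control hs).limUnder_eq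
  have hg : Summable fun k : ℕ => D * B * (((k : ℝ) + 1) * r ^ k) :=
    (summable_add_one_mul_pow hr hr1).mul_left _
  rw [hlim, control_eq, add_sub_add_left_eq_sub, ← hs.sum_add_tsum_nat_add (N + 1),
    add_sub_cancel_left]
  exact tsum_of_norm_bounded ((summable_nat_add_iff (N + 1)).2 hg).hasSum fun k => h _

end TrackingProblem

/-! ### The main theorem. -/

theorem corollary5 {n m p : ℕ} (T : TrackingProblem n m p)
    (hW : T.W.PosDef) (hV : T.V.PosDef)
    (hcontr : IsControllable T.A T.B) (hdet : IsDetectable T.Phi T.H) :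
    -- the Kalman recursion converges, and the limiting closed loop is stable
    (∃ P : Matrix (Fin n ⊕ Fin m) (Fin n ⊕ Fin m) ℝ,
      Tendsto T.prior atTop (𝓝 P) ∧ EigenvaluesLt (T.closedLoop P) 1 ∧
      -- every `r < 1` above the largest eigenvalue modulus is a geometric rate
      ∀ r : ℝ, 0 < r → r < 1 → EigenvaluesLt (T.closedLoop P) r →
        ∃ c γ₁ γ₂ : ℝ, T.GainBounds r c γ₁ γ₂) ∧
    -- the infinite-horizon control exists for references with bounded increments
    (∀ (x : EuclideanSpace ℝ (Fin n)) (u : EuclideanSpace ℝ (Fin m))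
      (z : ℕ → EuclideanSpace ℝ (Fin p)) (δ : ℝ) (N : ℕ),
      (∀ k, N < k → ‖z k - z (k - 1)‖ < δ) →
      Tendsto (fun M => T.control M x u z) atTop (𝓝 (T.controlInf x u z))) ∧
    -- explicit bound of the effect of the increments beyond `N`
    (∀ r c γ₁ γ₂ : ℝ, 0 < r → r < 1 → T.GainBounds r c γ₁ γ₂ →
      ∀ (N : ℕ) (δ : ℝ) (x : EuclideanSpace ℝ (Fin n)) (u : EuclideanSpace ℝ (Fin m))
        (z : ℕ → EuclideanSpace ℝ (Fin p)),
        (∀ k, N < k → ‖z k - z (k - 1)‖ < δ) →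
        ‖T.controlInf x u z - T.controlKnown N x u z‖ ≤
          (‖T.GPrev 1‖ * c * (γ₁ / r) * r ^ (N + 1) / (1 - r) ^ 2 +
            ‖T.GPrev 1‖ * c ^ 2 * γ₂ * r ^ (N + 1) / ((1 - r ^ 2) * (1 - r) ^ 2)) * δ) ∧
    -- a finite horizon makes this effect smaller than any `ε`, uniformly in state and reference
    (∀ ε δ : ℝ, 0 < ε → 0 < δ → ∃ N₀ : ℕ, ∀ N, N₀ ≤ N →
      ∀ (x : EuclideanSpace ℝ (Fin n)) (u : EuclideanSpace ℝ (Fin m))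
        (z : ℕ → EuclideanSpace ℝ (Fin p)),
        (∀ k, N < k → ‖z k - z (k - 1)‖ < δ) →
        ‖T.controlInf x u z - T.controlKnown N x u z‖ < ε) ∧
    -- the same for the control computed with the truncated horizon `N`, along references with
    -- increments below `δ`, uniformly for bounded initial data
    (∀ ε δ ρ : ℝ, 0 < ε → 0 < δ → 0 < ρ → ∃ N₀ : ℕ, ∀ N, N₀ ≤ N →
      ∀ (x : EuclideanSpace ℝ (Fin n)) (u : EuclideanSpace ℝ (Fin m))
        (z : ℕ → EuclideanSpace ℝ (Fin p)),
        ‖x‖ ≤ ρ → ‖u‖ ≤ ρ → ‖z 0‖ ≤ ρ → (∀ k, 0 < k → ‖z k - z (k - 1)‖ < δ) →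
        ‖T.controlInf x u z - T.control N x u z‖ < ε) := by
  obtain ⟨P, hP, hlim, hstab⟩ := T.exists_tendsto_prior hW hV hcontr hdet
  have hbounds : ∀ r : ℝ, 0 < r → r < 1 → EigenvaluesLt (T.closedLoop P) r →
      ∃ c γ₁ γ₂ : ℝ, T.GainBounds r c γ₁ γ₂ :=
    fun r hr _ h => T.exists_gainBounds hW hP hlim hr h
  obtain ⟨q, hq0, hq1, hq⟩ := hstab.exists_lt one_pos
  obtain ⟨c, γ₁, γ₂, hG⟩ := hbounds q hq0 hq1 hq
  obtain ⟨κ, hκ⟩ : ∃ κ, ∀ k, ‖T.K k‖ ≤ κ := by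
    have hK : Tendsto T.K atTop (𝓝 (kalmanGain T.H T.Rn P)) :=
      (tendsto_add_atTop_iff_nat 1).1 ((continuousAt_kalmanGain T.H (T.Rn_posDef hW) hP).tendsto.comp
        (hlim.comp (tendsto_add_atTop_nat 1)))
    obtain ⟨κ, hκ⟩ := hK.norm.bddAbove_range
    exact ⟨κ, fun k => hκ ⟨k, rfl⟩⟩
  obtain ⟨D, hD⟩ := hG.exists_norm_controlTerm_le hq0 hq1 hκ
  have hconv : ∀ (x : EuclideanSpace ℝ (Fin n)) (u : EuclideanSpace ℝ (Fin m))
      (z : ℕ → EuclideanSpace ℝ (Fin p)) (δ : ℝ) (N : ℕ),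
      (∀ k, N < k → ‖z k - z (k - 1)‖ < δ) →
      Tendsto (fun M => T.control M x u z) atTop (𝓝 (T.controlInf x u z)) := by
    intro x u z δ N hz
    -- The strict increment bound itself forces `δ` to be positive.
    have hδ : 0 < δ := (norm_nonneg _).trans_lt (hz (N + 1) N.lt_succ_self)
    set a := ∑ i ∈ Finset.range (N + 1), ‖z i‖ with ha
    have ha0 : 0 ≤ a := Finset.sum_nonneg fun i _ => norm_nonneg _
    have hs := TrackingProblem.summable_controlTerm hq0 hq1 (hD (‖x‖ + ‖u‖ + a + δ) x u z (by linarith) fun k => by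
      have h1 := TrackingProblem.norm_le_of_increments hδ.le (fun k hk => (hz k hk).le) k
      have h2 : 0 ≤ (k : ℝ) := k.cast_nonneg
      nlinarith [mul_nonneg h2 ha0, mul_nonneg h2 (norm_nonneg x), mul_nonneg h2 (norm_nonneg u),
        norm_nonneg x, norm_nonneg u])
    exact tendsto_nhds_limUnder ⟨_, TrackingProblem.tendsto_control hs⟩
  have hexplicit : ∀ r c γ₁ γ₂ : ℝ, 0 < r → r < 1 → T.GainBounds r c γ₁ γ₂ →
      ∀ (N : ℕ) (δ : ℝ) (x : EuclideanSpace ℝ (Fin n)) (u : EuclideanSpace ℝ (Fin m))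
        (z : ℕ → EuclideanSpace ℝ (Fin p)),
        (∀ k, N < k → ‖z k - z (k - 1)‖ < δ) →
        ‖T.controlInf x u z - T.controlKnown N x u z‖ ≤
          (‖T.GPrev 1‖ * c * (γ₁ / r) * r ^ (N + 1) / (1 - r) ^ 2 +
            ‖T.GPrev 1‖ * c ^ 2 * γ₂ * r ^ (N + 1) / ((1 - r ^ 2) * (1 - r) ^ 2)) * δ := by
    intro r c γ₁ γ₂ hr hr1 h N δ x u z hz
    have hδ : 0 < δ := (norm_nonneg _).trans_lt (hz (N + 1) N.lt_succ_self)
    have h1 := hconv x u z δ N hz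
    -- The clamped reference has zero increments after `N`, so its control converges too.
    have h2 := hconv x u (fun k => z (min k N)) δ N fun k hk => by
      simpa only [min_eq_right hk.le, min_eq_right (Nat.le_sub_one_of_lt hk), sub_self,
        norm_zero] using hδ
    have h3 := ((h1.sub h2).norm).comp (tendsto_add_atTop_nat N)
    refine le_of_tendsto h3 (Eventually.of_forall fun J => ?_)
    simp only [Function.comp_apply]
    rw [TrackingProblem.control_sub, show J + N + 1 = N + 1 + J by omega]
    refine h.norm_sum_controlTerm_le hr hr1 hδ.le (fun k hk => ?_) (fun i => ?_) J
    · simp [min_eq_left hk]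
    · exact TrackingProblem.norm_sub_min_le (fun k hk => (hz k hk).le) i
  refine ⟨⟨P, hlim, hstab, hbounds⟩, hconv, hexplicit, ?_, ?_⟩
  · intro ε δ hε hδ
    have hlim0 : Tendsto (fun N : ℕ => (‖T.GPrev 1‖ * c * (γ₁ / q) * q ^ (N + 1) / (1 - q) ^ 2 +
        ‖T.GPrev 1‖ * c ^ 2 * γ₂ * q ^ (N + 1) / ((1 - q ^ 2) * (1 - q) ^ 2)) * δ)
        atTop (𝓝 0) := by
      have hp := (tendsto_pow_atTop_nhds_zero_of_lt_one hq0.le hq1).comp (tendsto_add_atTop_nat 1)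
      simpa using (((hp.const_mul (‖T.GPrev 1‖ * c * (γ₁ / q))).div_const ((1 - q) ^ 2)).add
        ((hp.const_mul (‖T.GPrev 1‖ * c ^ 2 * γ₂)).div_const
          ((1 - q ^ 2) * (1 - q) ^ 2))).mul_const δ
    obtain ⟨N₀, hN₀⟩ := eventually_atTop.1 (hlim0.eventually (gt_mem_nhds hε))
    exact ⟨N₀, fun N hN x u z hz =>
      (hexplicit q c γ₁ γ₂ hq0 hq1 hG N δ x u z hz).trans_lt (hN₀ N hN)⟩
  · intro ε δ ρ hε hδ hρ
    -- The scale `2 * ρ + δ` dominates `‖x‖ + ‖u‖`, and times `k + 1` it dominates `‖z k‖ ≤ ρ + k *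
    -- δ`.
    have htail := (tendsto_sum_nat_add fun k : ℕ =>
      D * (2 * ρ + δ) * (((k : ℝ) + 1) * q ^ k)).comp (tendsto_add_atTop_nat 1)
    obtain ⟨N₀, hN₀⟩ := eventually_atTop.1 (htail.eventually (gt_mem_nhds hε))
    refine ⟨N₀, fun N hN x u z hx hu hz0 hz => ?_⟩
    refine (TrackingProblem.norm_controlInf_sub_control_le hq0 hq1
      (hD (2 * ρ + δ) x u z (by linarith) fun k => ?_) N).trans_lt (hN₀ N hN)
    have h1 := TrackingProblem.norm_le_of_increments hδ.le (fun k hk => (hz k hk).le) k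
    simp only [zero_add, Finset.sum_range_one] at h1
    have h2 : 0 ≤ (k : ℝ) := k.cast_nonneg
    nlinarith [mul_nonneg h2 hρ.le]
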